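/- Let $k\ge 1$ and let $\Lambda$ be a nonempty, finite, strongly connected $k$-graph with adjacency matrices $A_1,\dots,A_k$, and suppose that $A=A_1\cdots A_k$ is irreducible. Let $\rho_i$ be the spectral radius of $A_i$, write $\rho(\Lambda)^n=\rho_1^{n_1}\cdots\rho_k^{n_k}$ for $n\in\mathbb N^k$, let $x^\Lambda$ be the positive vector with $\sum_v x^\Lambda_v=1$ and $A_ix^\Lambda=\rho_ix^\Lambda$ for all $i$, and let $M$ be the Borel probability measure on the infinite path space $\Lambda^\infty$ with $M([\lambda])=\rho(\Lambda)^{-d(\lambda)}x^\Lambda_{s(\lambda)}$ for all $\lambda\in\Lambda$ (both exist). Let $\mathcal B_\Lambda$ be the stationary $k$-Bratteli diagram of $\Lambda$: all levels $\mathcal V_n$ ($n\ge0$) are copies of $\Lambda^0$, and the edges from $\mathcal V_{n}$ to $\mathcal V_{n-1}$ are the edges of $\Lambda$ of color $i$, where $i\equiv n \pmod k$, $1\le i\le k$. Its infinite path space is identified with $\Lambda^\infty$. Let $F\mathcal B_\Lambda$ be the set of its finite paths $\gamma$ with range in $\mathcal V_0$ (vertices of $\mathcal V_0$ are the paths of length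 $|\gamma|=0$), let $[\gamma]\subseteq\Lambda^\infty$ be the cylinder set of $\gamma$, and let $\mathrm{ext}_1(\gamma)$ be the set of pairs $(e,e')$ of edges with $e\ne e'$ and $r(e)=r(e')=s(\gamma)$. For $\delta\in(0,1)$ and $|\gamma|=qk+t$, $0\le t<k$, let $$w_\delta(\gamma)=\left(\rho_1^{q+1}\cdots\rho_t^{q+1}\rho_{t+1}^q\cdots\rho_k^q\right)^{-1/\delta}x^\Lambda_{s(\gamma)}.$$ Let $d(x,y)$ be $0$ if $x=y$, be $1$ if $x,y\in\Lambda^\infty$ have different ranges, and otherwise be the value of $w_\delta$ at the longest common initial segment of $x$ and $y$ in $\mathcal B_\Lambda$. Suppose that $w_\delta$ is a weight on $\mathcal B_\Lambda$ (that is, $w_\delta>0$, $\sum_{v\in\mathcal V_0}w_\delta(v)\le1$, $\sup_{|\gamma|=n}w_\delta(\gamma)\to0$ as $n\to\infty$, and $w_\delta$ is strictly smaller on proper extensions of a path) and that $w_\delta(\gamma)=\operatorname{diam}[\gamma]$ for the metric $d$, for every $\gamma\in F\mathcal B_\Lambda$. In $L^2(\Lambda^\infty,M)$ put, for $n\in\mathbb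 N$ and $\gamma\in F\mathcal B_\Lambda$, $$\mathscr V_n=\operatorname{span}\{\chi_{[\lambda]}:d(\lambda)=(n,\dots,n)\},\qquad \mathcal W_n=\mathscr V_{n+1}\cap\mathscr V_n^\perp,\qquad E_{-1}=\operatorname{span}\{\chi_{\Lambda^\infty}\},$$ $$E_0=\operatorname{span}\Big\{\tfrac{1}{M([v])}\chi_{[v]}-\tfrac1{M([v'])}\chi_{[v']}:v\ne v'\in\mathcal V_0\Big\},\qquad E_\gamma=\operatorname{span}\Big\{\tfrac{1}{M([\gamma e])}\chi_{[\gamma e]}-\tfrac1{M([\gamma e'])}\chi_{[\gamma e']}:(e,e')\in\mathrm{ext}_1(\gamma)\Big\}.$$ For $s\in\mathbb R$ let $\Delta_s$ be the Laplace–Beltrami operator on the span of the functions $\chi_{[\gamma]}$, given by $$\langle f,\Delta_s g\rangle=Q_s(f,g)=\tfrac12\int\operatorname{Tr}\big(|D|^{-s}[D,\pi_\tau(f)]^*[D,\pi_\tau(g)]\big)\,dN(\tau),$$ where $D=\bigoplus_\gamma\frac1{\operatorname{diam}[\gamma]}\begin{pmatrix}0&1\\1&0\end{pmatrix}$ and $\pi_\tau(f)=\bigoplus_\gamma\begin{pmatrix}f(\tau_+(\gamma))&0\\0&f(\tau_-(\gamma))\end{pmatrix}$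 on $\ell^2(F\mathcal B_\Lambda,\mathbb C^2)$, and $N=\prod_\gamma N_\gamma$ is the product probability measure on the choice functions $\tau=(\tau_+,\tau_-)$, with $N_\gamma$ the normalized restriction of $M\times M$ to $\{(x,y)\in[\gamma]\times[\gamma]:d(x,y)=\operatorname{diam}[\gamma]\}$. Then the eigenspaces of the operators $\Delta_s$ refine the wavelet decomposition $$L^2(\Lambda^\infty,M)=\mathscr V_0\oplus\bigoplus_{n\in\mathbb N}\mathcal W_n$$ (an orthogonal direct sum of Hilbert spaces). Precisely: for every $s\in\mathbb R$, each of the spaces $E_{-1}$, $E_0$ and $E_\gamma$ ($\gamma\in F\mathcal B_\Lambda$) consists of eigenvectors of $\Delta_s$ for a single eigenvalue (together with $0$); the spaces $E_\gamma$ are pairwise orthogonal; and $$\mathscr V_0=E_{-1}\oplus E_0,\qquad \mathcal W_n=\operatorname{span}\{E_\gamma:\gamma\in F\mathcal B_\Lambda,\ nk\le|\gamma|<(n+1)k\}\quad(n\in\mathbb N),$$ where the first sum is orthogonal. -/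

import Mathlib

open MeasureTheory Filter Topology

universe u

/-! ## Bratteli diagrams, weights and ultrametrics -/

/-- A Bratteli diagram. `V n` is the (finite) set of vertices at level `n`, and `E n p q` is the
(finite) set of edges with range `p` at level `n` and source `q` at level `n + 1`. -/
structure BratteliDiagram where
  V : ℕ → Type u
  E : (n : ℕ) → V n → V (n + 1) → Type u
  finite_V : ∀ n, Finite (V n)
  finite_E : ∀ n p q, Finite (E n p q)

namespace BratteliDiagram

/-- `B.Path n p`: finite paths `γ₁ ⋯ γₙ` with range at level `0` and source `p` at level `n`;
a path of length `0` is a vertex of level `0`. -/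
inductive Path (B : BratteliDiagram.{u}) : (n : ℕ) → B.V n → Type u
  | vertex (v : B.V 0) : Path B 0 v
  | snoc {n : ℕ} {p : B.V n} {q : B.V (n + 1)} (γ : Path B n p) (e : B.E n p q) :
      Path B (n + 1) q

/-- The set `Fℬ` of all finite paths with range at level `0`. -/
structure FinPath (B : BratteliDiagram.{u}) where
  len : ℕ
  src : B.V len
  path : B.Path len src

/-- A vertex of level `0`, as a path of length `0`. -/
def FinPath.vertex {B : BratteliDiagram.{u}} (v : B.V 0) : B.FinPath := ⟨0, v, .vertex v⟩

/-- The path `γ e`. -/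
def FinPath.snoc {B : BratteliDiagram.{u}} (γ : B.FinPath) {q : B.V (γ.len + 1)}
    (e : B.E γ.len γ.src q) : B.FinPath := ⟨γ.len + 1, q, γ.path.snoc e⟩

/-- The edges `e` with `r(e) = s(γ)`, each given together with its source. -/
abbrev FinPath.Ext {B : BratteliDiagram.{u}} (γ : B.FinPath) : Type u :=
  Σ q : B.V (γ.len + 1), B.E γ.len γ.src q

/-- `η.IsSubpath γ`: `γ` is obtained from `η` by appending finitely many (maybe no) edges. -/
inductive FinPath.IsSubpath {B : BratteliDiagram.{u}} (η : B.FinPath) : B.FinPath → Prop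
  | refl : IsSubpath η η
  | snoc {γ : B.FinPath} {q : B.V (γ.len + 1)} (h : IsSubpath η γ) (e : B.E γ.len γ.src q) :
      IsSubpath η (γ.snoc e)

/-- The space `X_ℬ` of infinite paths. -/
structure InfPath (B : BratteliDiagram.{u}) where
  vert : ∀ n, B.V n
  edge : ∀ n, B.E n (vert n) (vert (n + 1))

/-- The first `n` edges of an infinite path. -/
def InfPath.initial {B : BratteliDiagram.{u}} (x : B.InfPath) : (n : ℕ) → B.Path n (x.vert n)
  | 0 => .vertex (x.vert 0)
  | n + 1 => (x.initial n).snoc (x.edge n)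

/-- The sub-path of length `n` of an infinite path. -/
def InfPath.trunc {B : BratteliDiagram.{u}} (x : B.InfPath) (n : ℕ) : B.FinPath :=
  ⟨n, x.vert n, x.initial n⟩

/-- The cylinder set `[γ]` of infinite paths with initial segment `γ`. -/
def cylinder {B : BratteliDiagram.{u}} (γ : B.FinPath) : Set B.InfPath :=
  {x | x.trunc γ.len = γ}

/-- A weight on a Bratteli diagram. -/
structure IsWeight {B : BratteliDiagram.{u}} (w : B.FinPath → ℝ) : Prop where
  pos : ∀ γ, 0 < w γ
  sum_le : ∑ᶠ v : B.V 0, w (.vertex v) ≤ 1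
  tendsto : Tendsto (fun n : ℕ => sSup (w '' {γ | γ.len = n})) atTop (𝓝 0)
  strict : ∀ η γ : B.FinPath, η.IsSubpath γ → η ≠ γ → w γ < w η

open Classical in
/-- The ultrametric `d_w`: it is `1` if `x` and `y` have no common sub-path (not even a common
range), `0` if `x = y`, and `w (x ∧ y)` otherwise, where `x ∧ y` is the longest common sub-path. -/
noncomputable def dist {B : BratteliDiagram.{u}} (w : B.FinPath → ℝ) (x y : B.InfPath) : ℝ :=
  if x.trunc 0 ≠ y.trunc 0 then 1
  else if x = y then 0
  else w (x.trunc (sSup {n | x.trunc n = y.trunc n}))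

/-- The diameter of the cylinder set `[γ]` for `d_w`. -/
noncomputable def diam {B : BratteliDiagram.{u}} (w : B.FinPath → ℝ) (γ : B.FinPath) : ℝ :=
  sSup {d | ∃ x ∈ cylinder γ, ∃ y ∈ cylinder γ, d = dist w x y}

end BratteliDiagram

/-! ## Higher-rank graphs -/

/-- A `k`-graph, in the arrows-only picture: a countable small category with objects `Obj`,
morphisms `Mor`, range `r`, source `s`, identities `one` and composition `comp f g = f g` (defined
when `s f = r g`), with a degree functor to `ℕ^k` that has the unique factorization property. -/
structure KGraph (k : ℕ) where
  Obj : Type u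
  Mor : Type u
  r : Mor → Obj
  s : Mor → Obj
  one : Obj → Mor
  comp : (f g : Mor) → s f = r g → Mor
  r_one : ∀ v, r (one v) = v
  s_one : ∀ v, s (one v) = v
  r_comp : ∀ f g h, r (comp f g h) = r f
  s_comp : ∀ f g h, s (comp f g h) = s g
  one_comp : ∀ f, comp (one (r f)) f (s_one _) = f
  comp_one : ∀ f, comp f (one (s f)) (r_one _).symm = f
  assoc : ∀ (f g h : Mor) (hfg : s f = r g) (hgh : s g = r h),
    comp (comp f g hfg) h ((s_comp f g hfg).trans hgh)
      = comp f (comp g h hgh) (hfg.trans (r_comp g h hgh).symm)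
  countable : Countable Mor
  deg : Mor → (Fin k → ℕ)
  deg_one : ∀ v, deg (one v) = 0
  deg_comp : ∀ f g h, deg (comp f g h) = deg f + deg g
  factorization : ∀ (f : Mor) (m n : Fin k → ℕ), deg f = m + n →
    ∃! p : Mor × Mor, deg p.1 = m ∧ deg p.2 = n ∧ ∃ h : s p.1 = r p.2, comp p.1 p.2 h = f

namespace KGraph

variable {k : ℕ}

/-- `Λ` is finite: each set `Λ^n` is finite. -/
class IsFinite (Λ : KGraph.{u} k) : Prop where
  finite_deg : ∀ n : Fin k → ℕ, {f : Λ.Mor | Λ.deg f = n}.Finite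

/-- `Λ` is strongly connected: `v Λ w` is nonempty for all vertices `v`, `w`. -/
def StronglyConnected (Λ : KGraph.{u} k) : Prop :=
  ∀ v w : Λ.Obj, ∃ f : Λ.Mor, Λ.r f = v ∧ Λ.s f = w

instance instFiniteObj (Λ : KGraph.{u} k) [h : Λ.IsFinite] : Finite Λ.Obj := by
  have h0 : Finite {f : Λ.Mor | Λ.deg f = 0} := (h.finite_deg 0).to_subtype
  refine Finite.of_injective
    (fun v => (⟨Λ.one v, Λ.deg_one v⟩ : {f : Λ.Mor | Λ.deg f = 0})) fun v w hvw => ?_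
  have h1 : Λ.one v = Λ.one w := congrArg Subtype.val hvw
  rw [← Λ.r_one v, h1, Λ.r_one]

noncomputable instance instFintypeObj (Λ : KGraph.{u} k) [Λ.IsFinite] : Fintype Λ.Obj :=
  Fintype.ofFinite _

noncomputable instance instDecidableEqObj (Λ : KGraph.{u} k) : DecidableEq Λ.Obj :=
  Classical.decEq _

/-- The edges of color `i` with range `v` and source `w`. -/
abbrev ColorEdge (Λ : KGraph.{u} k) (i : Fin k) (v w : Λ.Obj) : Type u :=
  {f : Λ.Mor // Λ.deg f = Pi.single i 1 ∧ Λ.r f = v ∧ Λ.s f = w}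

/-- The adjacency matrix `A_i` (with real entries). -/
noncomputable def adj (Λ : KGraph.{u} k) (i : Fin k) : Matrix Λ.Obj Λ.Obj ℝ :=
  fun v w => (Nat.card (Λ.ColorEdge i v w) : ℝ)

/-- The product `A = A_1 ⋯ A_k`. -/
noncomputable def adjProd (Λ : KGraph.{u} k) [Λ.IsFinite] : Matrix Λ.Obj Λ.Obj ℝ :=
  (List.ofFn Λ.adj).prod

/-- The spectral radius `ρ_i` of `A_i`. -/
noncomputable def rho (Λ : KGraph.{u} k) [Λ.IsFinite] (i : Fin k) : ℝ :=
  (spectralRadius ℂ ((Λ.adj i).map (fun a : ℝ => (a : ℂ)))).toReal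

/-- `ρ(Λ)^n` for `n ∈ ℕ^k`. -/
noncomputable def rhoPow (Λ : KGraph.{u} k) [Λ.IsFinite] (n : Fin k → ℕ) : ℝ :=
  ∏ i, Λ.rho i ^ n i

/-- `x` is a positive common eigenvector of the `A_i`, with eigenvalues `ρ_i` and total mass
`1`. -/
structure IsPerronFrobenius (Λ : KGraph.{u} k) [Λ.IsFinite] (x : Λ.Obj → ℝ) : Prop where
  pos : ∀ v, 0 < x v
  sum_eq : ∑ v, x v = 1
  eigen : ∀ i, (Λ.adj i).mulVec x = Λ.rho i • x

open Classical in
/-- The Perron-Frobenius eigenvector `x^Λ`: the vector with `IsPerronFrobenius`, which exists and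
is unique if `Λ` is finite, nonempty and strongly connected. -/
noncomputable def perron (Λ : KGraph.{u} k) [Λ.IsFinite] : Λ.Obj → ℝ :=
  if h : ∃ x, Λ.IsPerronFrobenius x then h.choose else 0

/-- Infinite paths of `Λ`: the `k`-graph morphisms `Ω_k → Λ`; the morphism `(m, n)` of `Ω_k`
(where `m ≤ n`) has range `m`, source `n` and degree `n - m`. -/
structure InfPath (Λ : KGraph.{u} k) where
  obj : (Fin k → ℕ) → Λ.Obj
  mor : (m n : Fin k → ℕ) → m ≤ n → Λ.Mor
  r_mor : ∀ m n h, Λ.r (mor m n h) = obj m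
  s_mor : ∀ m n h, Λ.s (mor m n h) = obj n
  mor_self : ∀ m, mor m m le_rfl = Λ.one (obj m)
  mor_comp : ∀ m n p (h : m ≤ n) (h' : n ≤ p),
    Λ.comp (mor m n h) (mor n p h') ((s_mor m n h).trans (r_mor n p h').symm)
      = mor m p (h.trans h')
  deg_mor : ∀ m n h, Λ.deg (mor m n h) = n - m

/-- The cylinder set `[f] = {x | x(0, d(f)) = f}` of a morphism `f`. -/
def cylinder {Λ : KGraph.{u} k} (f : Λ.Mor) : Set Λ.InfPath :=
  {x | x.mor 0 (Λ.deg f) zero_le = f}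

instance instTopInfPath (Λ : KGraph.{u} k) : TopologicalSpace Λ.InfPath :=
  TopologicalSpace.generateFrom (Set.range (cylinder (Λ := Λ)))

instance instMeasInfPath (Λ : KGraph.{u} k) : MeasurableSpace Λ.InfPath := borel _

instance instBorelInfPath (Λ : KGraph.{u} k) : BorelSpace Λ.InfPath := ⟨rfl⟩

theorem isOpen_cylinder {Λ : KGraph.{u} k} (f : Λ.Mor) : IsOpen (cylinder f) :=
  TopologicalSpace.isOpen_generateFrom_of_mem ⟨f, rfl⟩

/-- `M` is a Borel probability measure with `M([f]) = ρ(Λ)^{-d(f)} x^Λ_{s(f)}` for all `f`. -/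
structure IsPathMeasure (Λ : KGraph.{u} k) [Λ.IsFinite] (M : Measure Λ.InfPath) : Prop where
  prob : IsProbabilityMeasure M
  apply_cylinder : ∀ f : Λ.Mor,
    M (cylinder f) = ENNReal.ofReal ((Λ.rhoPow (Λ.deg f))⁻¹ * Λ.perron (Λ.s f))

open Classical in
/-- The measure `M` on `Λ^∞`: the measure with `IsPathMeasure`, which exists and is unique if `Λ`
is finite, nonempty and strongly connected. -/
noncomputable def measure (Λ : KGraph.{u} k) [Λ.IsFinite] : Measure Λ.InfPath :=
  if h : ∃ M, Λ.IsPathMeasure M then h.choose else 0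

instance instFiniteMeasure (Λ : KGraph.{u} k) [Λ.IsFinite] : IsFiniteMeasure Λ.measure := by
  unfold measure
  split_ifs with h
  · have := h.choose_spec.prob
    infer_instance
  · infer_instance

/-! ## The stationary `k`-Bratteli diagram of a `k`-graph -/

/-- The stationary `k`-Bratteli diagram `ℬ_Λ`: every level is a copy of the vertex set of `Λ`, and
the edges from level `n + 1` to level `n` are the edges of `Λ` of color `n mod k`, where colors
are numbered from `0`. In particular there are `A_i(p, q)` of them from `q` to `p`. -/
def bratteli (Λ : KGraph.{u} k) [NeZero k] [hΛ : Λ.IsFinite] : BratteliDiagram.{u} where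
  V _ := Λ.Obj
  E n p q := Λ.ColorEdge (Fin.ofNat k n) p q
  finite_V _ := inferInstance
  finite_E n _ _ := ((hΛ.finite_deg (Pi.single (Fin.ofNat k n) 1)).subset
    (fun _ hf => hf.1)).to_subtype

/-- For `n = q k + t` with `0 ≤ t < k`, the degree `(q+1, …, q+1, q, …, q)` with `t` entries
`q + 1`. -/
def rainbow (k n : ℕ) : Fin k → ℕ := fun i => n / k + if i.val < n % k then 1 else 0

theorem rainbow_succ (k n : ℕ) [NeZero k] :
    rainbow k (n + 1) = rainbow k n + Pi.single (Fin.ofNat k n) 1 := by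
  have hk : 0 < k := NeZero.pos k
  funext i
  have hi := i.isLt
  have hlt : n % k < k := Nat.mod_lt n hk
  have hdm := Nat.div_add_mod n k
  have hs : (Pi.single (Fin.ofNat k n) 1 : Fin k → ℕ) i = if i.val = n % k then 1 else 0 := by
    simp [Pi.single_apply, Fin.ext_iff, Fin.ofNat]
  simp only [rainbow, Pi.add_apply, hs]
  by_cases h : n % k + 1 = k
  · have hn : n + 1 = k * (n / k + 1) := by rw [Nat.mul_add]; omega
    have h1 : (n + 1) / k = n / k + 1 := by rw [hn, Nat.mul_div_cancel_left _ hk]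
    have h2 : (n + 1) % k = 0 := by rw [hn, Nat.mul_mod_right]
    rw [h1, h2]
    split_ifs <;> omega
  · have hn : n + 1 = (n % k + 1) + k * (n / k) := by omega
    have h1 : (n + 1) / k = n / k := by
      rw [hn, Nat.add_mul_div_left _ _ hk, Nat.div_eq_of_lt (by omega)]; simp
    have h2 : (n + 1) % k = n % k + 1 := by
      rw [hn, Nat.add_mul_mod_self_left, Nat.mod_eq_of_lt (by omega)]
    rw [h1, h2]
    split_ifs <;> omega

theorem rainbow_le_succ (k n : ℕ) [NeZero k] : rainbow k n ≤ rainbow k (n + 1) := by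
  rw [rainbow_succ]
  exact le_add_of_nonneg_right zero_le

/-- The identification of `Λ^∞` with the infinite path space of `ℬ_Λ`: it sends `x` to the sequence
of edges `f_1^1 f_2^1 ⋯ f_k^1 f_1^2 ⋯` of colors `1, 2, …, k, 1, 2, …` whose product is `x`. -/
def InfPath.toBratteli {Λ : KGraph.{u} k} [NeZero k] [Λ.IsFinite] (x : Λ.InfPath) :
    Λ.bratteli.InfPath where
  vert n := x.obj (rainbow k n)
  edge n := ⟨x.mor (rainbow k n) (rainbow k (n + 1)) (rainbow_le_succ k n),
    by rw [x.deg_mor, rainbow_succ, add_tsub_cancel_left], x.r_mor _ _ _, x.s_mor _ _ _⟩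

/-- The cylinder set `[γ] ⊆ Λ^∞` of a finite path `γ` of `ℬ_Λ`. -/
def pathCylinder {Λ : KGraph.{u} k} [NeZero k] [Λ.IsFinite] (γ : Λ.bratteli.FinPath) :
    Set Λ.InfPath :=
  InfPath.toBratteli ⁻¹' BratteliDiagram.cylinder γ

/-- The weight `w_δ` on `ℬ_Λ`. -/
noncomputable def weight (Λ : KGraph.{u} k) [NeZero k] [Λ.IsFinite] (δ : ℝ)
    (γ : Λ.bratteli.FinPath) : ℝ :=
  Λ.rhoPow (rainbow k γ.len) ^ (-1 / δ) * Λ.perron γ.src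

/-- `(ℬ_Λ, w_δ)` is a weighted Bratteli diagram with `w_δ(γ) = diam [γ]` for all `γ`. -/
structure WeightEqDiam (Λ : KGraph.{u} k) [NeZero k] [Λ.IsFinite] (δ : ℝ) : Prop where
  isWeight : BratteliDiagram.IsWeight (Λ.weight δ)
  eq_diam : ∀ γ : Λ.bratteli.FinPath, Λ.weight δ γ = BratteliDiagram.diam (Λ.weight δ) γ

/-! ### Measurability of cylinder sets -/

theorem InfPath.mor_eq_of_eq {Λ : KGraph.{u} k} {x y : Λ.InfPath} {p : Fin k → ℕ}
    (h : x.mor 0 p zero_le = y.mor 0 p zero_le) {m n : Fin k → ℕ} (hmn : m ≤ n)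
    (hnp : n ≤ p) : x.mor m n hmn = y.mor m n hmn := by
  have key : ∀ (a b c : Fin k → ℕ) (hab : a ≤ b) (hbc : b ≤ c),
      x.mor a c (hab.trans hbc) = y.mor a c (hab.trans hbc) →
      x.mor a b hab = y.mor a b hab ∧ x.mor b c hbc = y.mor b c hbc := by
    intro a b c hab hbc hac
    have hd : Λ.deg (x.mor a c (hab.trans hbc)) = (b - a) + (c - b) := by
      rw [x.deg_mor]
      funext i
      have h1 : a i ≤ b i := hab i
      have h2 : b i ≤ c i := hbc i
      simp only [Pi.sub_apply, Pi.add_apply]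
      omega
    have hu := (Λ.factorization _ _ _ hd).unique
      (y₁ := (x.mor a b hab, x.mor b c hbc)) (y₂ := (y.mor a b hab, y.mor b c hbc))
      ⟨x.deg_mor _ _ _, x.deg_mor _ _ _, _, x.mor_comp _ _ _ hab hbc⟩
      ⟨y.deg_mor _ _ _, y.deg_mor _ _ _, _, (y.mor_comp _ _ _ hab hbc).trans hac.symm⟩
    exact ⟨congrArg Prod.fst hu, congrArg Prod.snd hu⟩
  have h1 := (key 0 n p zero_le hnp h).1
  exact (key 0 m n zero_le hmn h1).2

theorem InfPath.trunc_eq_of_eq {Λ : KGraph.{u} k} [NeZero k] [Λ.IsFinite] {x y : Λ.InfPath}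
    (n : ℕ) (h : x.mor 0 (rainbow k n) zero_le = y.mor 0 (rainbow k n) zero_le) :
    x.toBratteli.trunc n = y.toBratteli.trunc n := by
  have aux : ∀ (n : ℕ) (p p' q q' : Λ.Obj) (γ : Λ.bratteli.Path n p) (γ' : Λ.bratteli.Path n p')
      (e : Λ.bratteli.E n p q) (e' : Λ.bratteli.E n p' q'),
      (⟨n, p, γ⟩ : Λ.bratteli.FinPath) = ⟨n, p', γ'⟩ → e.val = e'.val →
      (⟨n + 1, q, γ.snoc e⟩ : Λ.bratteli.FinPath) = ⟨n + 1, q', γ'.snoc e'⟩ := by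
    rintro n p p' q q' γ γ' ⟨e, he⟩ ⟨e', he'⟩ hγ hee
    cases hγ
    have hee' : e = e' := hee
    subst hee'
    obtain rfl : q = q' := he.2.2.symm.trans he'.2.2
    rfl
  induction n with
  | zero =>
    have h0 : x.obj (rainbow k 0) = y.obj (rainbow k 0) := by
      rw [← x.s_mor 0 _ zero_le, h, y.s_mor]
    change (⟨0, x.obj (rainbow k 0), .vertex _⟩ : Λ.bratteli.FinPath)
      = ⟨0, y.obj (rainbow k 0), .vertex _⟩
    rw [h0]
  | succ n ih =>
    exact aux n _ _ _ _ _ _ _ _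
      (ih (InfPath.mor_eq_of_eq h zero_le (rainbow_le_succ k n)))
      (InfPath.mor_eq_of_eq h (rainbow_le_succ k n) le_rfl)

theorem isOpen_pathCylinder {Λ : KGraph.{u} k} [NeZero k] [Λ.IsFinite]
    (γ : Λ.bratteli.FinPath) : IsOpen (pathCylinder γ) := by
  rw [isOpen_iff_forall_mem_open]
  intro x hx
  have hd : Λ.deg (x.mor 0 (rainbow k γ.len) zero_le) = rainbow k γ.len := by
    rw [x.deg_mor, tsub_zero]
  refine ⟨cylinder (x.mor 0 (rainbow k γ.len) zero_le), fun y hy => ?_, isOpen_cylinder _, ?_⟩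
  · have hy' : y.mor 0 (rainbow k γ.len) zero_le = x.mor 0 (rainbow k γ.len) zero_le := by
      have hy2 : y.mor 0 (Λ.deg (x.mor 0 (rainbow k γ.len) zero_le)) zero_le
          = x.mor 0 (rainbow k γ.len) zero_le := hy
      simpa only [hd] using hy2
    exact (InfPath.trunc_eq_of_eq γ.len hy').trans hx
  · change x.mor 0 (Λ.deg (x.mor 0 (rainbow k γ.len) zero_le)) zero_le = _
    simp only [hd]

/-! ## Subspaces of `L²(Λ^∞, M)` -/

/-- The Hilbert space `L²(Λ^∞, M)`. -/
abbrev L2 (Λ : KGraph.{u} k) [Λ.IsFinite] : Type u := Lp ℂ 2 Λ.measure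

/-- The characteristic function of a measurable set, as an element of `L²(Λ^∞, M)`. -/
noncomputable def chi {Λ : KGraph.{u} k} [Λ.IsFinite] {S : Set Λ.InfPath}
    (hS : MeasurableSet S) : Λ.L2 :=
  indicatorConstLp 2 hS (measure_ne_top Λ.measure S) (1 : ℂ)

/-- `χ_[f]` for a morphism `f` of `Λ`. -/
noncomputable def chiMor {Λ : KGraph.{u} k} [Λ.IsFinite] (f : Λ.Mor) : Λ.L2 :=
  chi (isOpen_cylinder f).measurableSet

/-- `χ_[γ]` for a finite path `γ` of `ℬ_Λ`. -/
noncomputable def chiPath {Λ : KGraph.{u} k} [NeZero k] [Λ.IsFinite]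
    (γ : Λ.bratteli.FinPath) : Λ.L2 :=
  chi (isOpen_pathCylinder γ).measurableSet

/-- `M([γ])⁻¹ χ_[γ]`. -/
noncomputable def chiNormalized {Λ : KGraph.{u} k} [NeZero k] [Λ.IsFinite]
    (γ : Λ.bratteli.FinPath) : Λ.L2 :=
  ((Λ.measure.real (pathCylinder γ) : ℝ) : ℂ)⁻¹ • chiPath γ

/-- The space `𝒱_n`. -/
noncomputable def scalingSpace (Λ : KGraph.{u} k) [Λ.IsFinite] (n : ℕ) : Submodule ℂ Λ.L2 :=
  Submodule.span ℂ {φ | ∃ f : Λ.Mor, (Λ.deg f = fun _ => n) ∧ φ = chiMor f}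

/-- The wavelet space `𝒲_n = 𝒱_{n+1} ∩ 𝒱_n^⊥`. -/
noncomputable def waveletSpace (Λ : KGraph.{u} k) [Λ.IsFinite] (n : ℕ) : Submodule ℂ Λ.L2 :=
  Λ.scalingSpace (n + 1) ⊓ (Λ.scalingSpace n)ᗮ

/-- The space `E_{-1}` of constants. -/
noncomputable def eigenspaceConst (Λ : KGraph.{u} k) [Λ.IsFinite] : Submodule ℂ Λ.L2 :=
  Submodule.span ℂ {chi (MeasurableSet.univ (α := Λ.InfPath))}

/-- The space `E_0`. -/
noncomputable def eigenspaceRoot (Λ : KGraph.{u} k) [NeZero k] [Λ.IsFinite] :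
    Submodule ℂ Λ.L2 :=
  Submodule.span ℂ {φ | ∃ v v' : Λ.bratteli.V 0, v ≠ v' ∧
    φ = chiNormalized (.vertex v) - chiNormalized (.vertex v')}

/-- The space `E_γ` of a finite path `γ`. -/
noncomputable def eigenspacePath (Λ : KGraph.{u} k) [NeZero k] [Λ.IsFinite]
    (γ : Λ.bratteli.FinPath) : Submodule ℂ Λ.L2 :=
  Submodule.span ℂ {φ | ∃ e e' : γ.Ext, e ≠ e' ∧
    φ = chiNormalized (γ.snoc e.2) - chiNormalized (γ.snoc e'.2)}

/-! ## The Laplace-Beltrami operators -/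

section LaplaceBeltrami

variable (Λ : KGraph.{u} k) [NeZero k] [Λ.IsFinite] (δ : ℝ)

/-- The possible values `(τ₊(γ), τ₋(γ))` at `γ` of a choice function: the pairs of points of `[γ]`
whose distance is the diameter of `[γ]`. The set of choice functions is the product of these
sets. -/
def choicePairs (γ : Λ.bratteli.FinPath) : Set (Λ.InfPath × Λ.InfPath) :=
  {p | p.1 ∈ pathCylinder γ ∧ p.2 ∈ pathCylinder γ ∧
    BratteliDiagram.dist (Λ.weight δ) p.1.toBratteli p.2.toBratteli
      = BratteliDiagram.diam (Λ.weight δ) γ}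

/-- The probability measure `N_γ`: the restriction of `M × M` to the possible values of choice
functions at `γ`, normalized. -/
noncomputable def choiceMeasureAt (γ : Λ.bratteli.FinPath) :
    Measure (Λ.InfPath × Λ.InfPath) :=
  ProbabilityTheory.cond (Λ.measure.prod Λ.measure) (Λ.choicePairs δ γ)

open Classical in
/-- The product probability measure `N = ∏_γ N_γ` on the space of choice functions. (Every `N_γ` is
a probability measure as soon as `WeightEqDiam` holds.) -/
noncomputable def choiceMeasure :
    Measure (Λ.bratteli.FinPath → Λ.InfPath × Λ.InfPath) :=
  if h : ∀ γ, IsProbabilityMeasure (Λ.choiceMeasureAt δ γ) then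
    haveI := h
    Measure.infinitePi (Λ.choiceMeasureAt δ)
  else 0

/-- The `γ`-block of the Dirac operator `D` on `ℓ²(Fℬ_Λ, ℂ²)`. -/
noncomputable def diracBlock (γ : Λ.bratteli.FinPath) : Matrix (Fin 2) (Fin 2) ℂ :=
  ((1 / BratteliDiagram.diam (Λ.weight δ) γ : ℝ) : ℂ) • !![0, 1; 1, 0]

/-- The `γ`-block of `|D|^{-s}`. -/
noncomputable def absDiracBlock (s : ℝ) (γ : Λ.bratteli.FinPath) : Matrix (Fin 2) (Fin 2) ℂ :=
  ((BratteliDiagram.diam (Λ.weight δ) γ ^ s : ℝ) : ℂ) • 1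

/-- The `γ`-block of the representation `π_τ(f)`. -/
def reprBlock (τ : Λ.bratteli.FinPath → Λ.InfPath × Λ.InfPath) (f : Λ.InfPath → ℂ)
    (γ : Λ.bratteli.FinPath) : Matrix (Fin 2) (Fin 2) ℂ :=
  !![f (τ γ).1, 0; 0, f (τ γ).2]

/-- The `γ`-block of the commutator `[D, π_τ(f)]`. -/
noncomputable def commutatorBlock (τ : Λ.bratteli.FinPath → Λ.InfPath × Λ.InfPath)
    (f : Λ.InfPath → ℂ) (γ : Λ.bratteli.FinPath) : Matrix (Fin 2) (Fin 2) ℂ :=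
  Λ.diracBlock δ γ * Λ.reprBlock τ f γ - Λ.reprBlock τ f γ * Λ.diracBlock δ γ

/-- The Dirichlet form
`Q_s(f, g) = 1/2 ∫ Tr(|D|^{-s} [D, π_τ(f)]^* [D, π_τ(g)]) dN(τ)`.
All operators under the trace are block diagonal, so the trace is the sum of the traces of the
blocks. It is used only for `f, g` in `formDomain`, where all but finitely many blocks of the
commutators vanish. -/
noncomputable def dirichletForm (s : ℝ) (f g : Λ.InfPath → ℂ) : ℂ :=
  1 / 2 * ∫ τ, ∑' γ : Λ.bratteli.FinPath, (Λ.absDiracBlock δ s γ *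
    (Λ.commutatorBlock δ τ f γ).conjTranspose * Λ.commutatorBlock δ τ g γ).trace
      ∂(Λ.choiceMeasure δ)

/-- The domain of `Q_s`: the span of the characteristic functions of the cylinder sets. -/
def formDomain : Submodule ℂ (Λ.InfPath → ℂ) :=
  Submodule.span ℂ {f | ∃ γ : Λ.bratteli.FinPath, f = (pathCylinder γ).indicator 1}

/-- The graph of the Laplace-Beltrami operator `Δ_s` on the (dense) span of the characteristic
functions of cylinder sets: `φ` belongs to that span, and `Δ_s φ = ψ`, that is,
`⟨g, ψ⟩ = Q_s(g, φ)` for all `g` in the span. -/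
def LaplaceBeltrami (s : ℝ) (φ ψ : Λ.L2) : Prop :=
  ∃ f ∈ Λ.formDomain, φ =ᵐ[Λ.measure] f ∧
    ∀ g ∈ Λ.formDomain, ∫ x, (starRingEnd ℂ) (g x) * ψ x ∂Λ.measure = Λ.dirichletForm δ s g f

/-- Every element of `E` is mapped by `Δ_s` to its multiple by one common eigenvalue. -/
def ConsistsOfEigenvectors (s : ℝ) (E : Submodule ℂ Λ.L2) : Prop :=
  ∃ c : ℝ, ∀ φ ∈ E, Λ.LaplaceBeltrami δ s φ ((c : ℂ) • φ)

end LaplaceBeltrami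

end KGraph

/-! ### Perron–Frobenius theory of irreducible matrices -/

namespace Matrix

variable {n : Type*} [Fintype n]

/-! Two facts carry the theorem: a path of the diagram of length `n * k` is the same thing as a
morphism of degree `(n, …, n)`, and the Dirichlet form is a sum over paths of terms that see only
how points branch at that path.

Decomposition. By unique factorization (`pathMor_injective`, `exists_pathMor_eq`), `𝒱_n` is the
space of functions of the first `n * k` edges (`scalingSpace_eq_levelSpace`). Passing from `m` to `m
+ 1` edges means allowing, on each `[γ]` with `|γ| = m`, a function of the next edge. Such a
function is a multiple of `χ_[γ]` plus one of mean zero, and the mean-zero ones are spanned by the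
normalized differences that span `E_γ` (`levelSpace_succ_le`). Mean zero on `[γ]` is orthogonality
to all functions of the first `|γ|` edges. Taking `k` such steps gives `𝒲_n` (`waveletSpace_eq`).
The same argument at the root, with vertices in place of edges, gives `𝒱_0`. Density holds because
path cylinders form a π-system that generates the Borel sets.

Eigenvectors. Under the weight hypotheses the pairs in `[η]` at distance `diam [η]` are exactly
those that branch at `η` (`choicePairs_eq`). Hence `Q_s(g, f)` is a weighted sum over `η` of
averages of `conj (g x - g y) * (f x - f y)` over such pairs. Let `f` be supported in `[γ]`, of mean
zero and dependent there only on the edge after `γ`. If `η` is longer than `γ`, or `[η]` misses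
`[γ]`, then `f` is constant on `[η]` and the term is zero. If `η = γ`, or `η` is a proper initial
segment of `γ`, expanding the product leaves a scalar times `⟨g, f⟩`, as the mean of `f` kills the
cross terms (`blockForm_self`, `blockForm_of_subset`). The scalars depend on `γ` and `η` alone, so
their weighted sum is one eigenvalue for all of `E_γ`. Functions of the range are constant on every
`[η]` and have eigenvalue `0`.

It remains to know that `x^Λ` and `M` exist. The `A_i` commute, so the Perron eigenvector of the
irreducible product `A` is common to them. It defines a Markov chain on edges, whose law is `M`. -/

theorem mulVec_pos_of_pos {B : Matrix n n ℝ} (hB : ∀ i j, 0 < B i j) {z : n → ℝ}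
    (hz : ∀ i, 0 ≤ z i) (hz0 : z ≠ 0) (i : n) : 0 < B.mulVec z i := by
  obtain ⟨j, hj⟩ := Function.ne_iff.1 hz0
  exact Finset.sum_pos' (fun a _ => mul_nonneg (hB i a).le (hz a))
    ⟨j, Finset.mem_univ j, mul_pos (hB i j) (lt_of_le_of_ne (hz j) (Ne.symm hj))⟩

variable [DecidableEq n]

/-- An irreducible matrix commutes with an entrywise positive polynomial in it. -/
theorem IsIrreducible.exists_pos_commute {A : Matrix n n ℝ} (hA : A.IsIrreducible) :
    ∃ B : Matrix n n ℝ, (∀ i j, 0 < B i j) ∧ Commute A B ∧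
      ∀ (x : n → ℝ) (r : ℝ), A.mulVec x = r • x → ∃ b : ℝ, B.mulVec x = b • x := by
  choose m _ hpos using (isIrreducible_iff_exists_pow_pos hA.nonneg).1 hA
  -- For each pair `(i, j)` irreducibility gives a power of `A` whose `(i, j)` entry is positive.
  -- All powers are nonnegative, so their sum is positive in every entry.
  refine ⟨∑ i, ∑ j, A ^ m i j, fun i j => ?_, ?_, fun x r hx => ?_⟩
  · simp only [Matrix.sum_apply]
    have hnn : ∀ a b, 0 ≤ (A ^ m a b) i j := fun a b => pow_apply_nonneg hA.nonneg _ i j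
    calc 0 < (A ^ m i j) i j := hpos i j
      _ ≤ ∑ b, (A ^ m i b) i j :=
        Finset.single_le_sum (f := fun b => (A ^ m i b) i j) (fun b _ => hnn i b)
          (Finset.mem_univ j)
      _ ≤ _ := Finset.single_le_sum (f := fun a => ∑ b, (A ^ m a b) i j)
          (fun a _ => Finset.sum_nonneg fun b _ => hnn a b) (Finset.mem_univ i)
  · exact Commute.sum_right _ _ _ fun i _ => Commute.sum_right _ _ _ fun j _ =>
      (Commute.refl A).pow_right _
  · have hp : ∀ k : ℕ, (A ^ k).mulVec x = r ^ k • x := by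
      intro k
      induction k with
      | zero => simp
      | succ k ih => rw [pow_succ, ← mulVec_mulVec, hx, mulVec_smul, ih, smul_smul, pow_succ']
    refine ⟨∑ i, ∑ j, r ^ m i j, ?_⟩
    simp only [sum_mulVec, hp, Finset.sum_smul]

/-- The Perron–Frobenius theorem: existence of a positive eigenvector. -/
theorem IsIrreducible.exists_pos_eigenvector [Nonempty n] {A : Matrix n n ℝ}
    (hA : A.IsIrreducible) :
    ∃ (x : n → ℝ) (r : ℝ), (∀ v, 0 < x v) ∧ ∑ v, x v = 1 ∧ A.mulVec x = r • x := by
  obtain ⟨B, hB, hcomm, heig⟩ := hA.exists_pos_commute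
  set C : ℝ := ∑ i, ∑ j, A i j with hC
  have hbound : ∀ (x : n → ℝ) (r : ℝ), (∀ v, 0 ≤ x v) → ∑ v, x v = 1 →
      (∀ v, r * x v ≤ A.mulVec x v) → r ≤ C := by
    intro x r hx hx1 hr
    have hx_le : ∀ v, x v ≤ 1 := fun v =>
      hx1 ▸ Finset.single_le_sum (fun a _ => hx a) (Finset.mem_univ v)
    calc r = ∑ v, r * x v := by rw [← Finset.mul_sum, hx1, mul_one]
      _ ≤ ∑ v, A.mulVec x v := Finset.sum_le_sum fun v _ => hr v
      _ ≤ C := Finset.sum_le_sum fun v _ => Finset.sum_le_sum fun w _ =>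
        mul_le_of_le_one_right (hA.nonneg v w) (hx_le w)
  -- The Collatz–Wielandt set: pairs with `r x ≤ A x` and `x` in the simplex. The cutoff at `C`
  -- makes it compact and, by `hbound`, excludes no nonnegative `r`. The eigenvalue will be the
  -- largest `r` in it.
  set K : Set ((n → ℝ) × ℝ) :=
    (stdSimplex ℝ n ×ˢ Set.Icc 0 C) ∩ {p | ∀ v, p.2 * p.1 v ≤ A.mulVec p.1 v} with hK
  have hKc : IsCompact K := by
    refine ((isCompact_stdSimplex ℝ n).prod isCompact_Icc).inter_right ?_
    simp only [Set.ofPred_forall]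
    refine isClosed_iInter fun v => isClosed_le (by fun_prop) ?_
    simp only [mulVec, dotProduct]
    fun_prop
  have hKn : K.Nonempty := by
    obtain ⟨v⟩ := ‹Nonempty n›
    refine ⟨(Pi.single v 1, 0), ⟨single_mem_stdSimplex ℝ v, le_rfl, ?_⟩, fun w => ?_⟩
    · exact Finset.sum_nonneg fun i _ => Finset.sum_nonneg fun j _ => hA.nonneg i j
    · simpa using hA.nonneg w v
  obtain ⟨⟨x, r⟩, ⟨⟨⟨hx0, hx1⟩, hr⟩, hle⟩, hmax⟩ :=
    hKc.exists_isMaxOn hKn continuous_snd.continuousOn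
  have hxne : x ≠ 0 := by rintro rfl; simp at hx1
  have hr0 : 0 ≤ r := hr.1
  have hy : ∀ v, 0 < B.mulVec x v := mulVec_pos_of_pos hB hx0 hxne
  have hAx : A.mulVec x = r • x := by
    -- If `r x ≤ A x` is not an equality, applying `B` makes it strict in every coordinate for `B
    -- x`. The smallest relative slack `ε` then allows `r + ε` with the normalized `B x`, against
    -- maximality.
    by_contra hne
    have hz0 : A.mulVec x - r • x ≠ 0 := sub_ne_zero.2 hne
    have hBz := mulVec_pos_of_pos hB
      (fun v => by simpa using hle v) hz0
    have hBz' : ∀ v, B.mulVec (A.mulVec x - r • x) v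
        = A.mulVec (B.mulVec x) v - r * B.mulVec x v := by
      intro v
      rw [mulVec_sub, mulVec_smul, mulVec_mulVec, mulVec_mulVec, hcomm.eq]
      simp
    obtain ⟨w, hw⟩ := Finite.exists_min fun v =>
      (A.mulVec (B.mulVec x) v - r * B.mulVec x v) / B.mulVec x v
    set ε := (A.mulVec (B.mulVec x) w - r * B.mulVec x w) / B.mulVec x w
    have hε : 0 < ε := div_pos (hBz' w ▸ hBz w) (hy w)
    set S := ∑ v, B.mulVec x v with hS
    have hSpos : 0 < S := Finset.sum_pos (fun v _ => hy v) Finset.univ_nonempty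
    have hnn : ∀ v, 0 ≤ (S⁻¹ • B.mulVec x) v := fun v =>
      mul_nonneg (inv_nonneg.2 hSpos.le) (hy v).le
    have hsum : ∑ v, (S⁻¹ • B.mulVec x) v = 1 := by
      simp only [Pi.smul_apply, smul_eq_mul, ← Finset.mul_sum, ← hS]
      exact inv_mul_cancel₀ hSpos.ne'
    have hge : ∀ v, (r + ε) * (S⁻¹ • B.mulVec x) v ≤ A.mulVec (S⁻¹ • B.mulVec x) v := by
      intro v
      have h1 := (le_div_iff₀ (hy v)).1 (hw v)
      rw [mulVec_smul]
      simp only [Pi.smul_apply, smul_eq_mul]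
      have h2 : (r + ε) * B.mulVec x v ≤ A.mulVec (B.mulVec x) v := by linarith
      calc _ = S⁻¹ * ((r + ε) * B.mulVec x v) := by ring
        _ ≤ _ := mul_le_mul_of_nonneg_left h2 (inv_nonneg.2 hSpos.le)
    have hm := hmax (show (S⁻¹ • B.mulVec x, r + ε) ∈ K from
      ⟨⟨⟨hnn, hsum⟩, by change 0 ≤ r + ε; linarith, hbound _ _ hnn hsum hge⟩, hge⟩)
    have hm' : r + ε ≤ r := hm
    linarith
  -- A zero coordinate of `x` would be one of `B x = b • x`, which is positive.
  obtain ⟨b, hb⟩ := heig x r hAx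
  refine ⟨x, r, fun v => lt_of_le_of_ne (hx0 v) fun h0 => ?_, hx1, hAx⟩
  have := hy v
  rw [hb, Pi.smul_apply, ← h0, smul_zero] at this
  exact this.false

/-- The Perron–Frobenius eigenvalue of an irreducible matrix is geometrically simple. -/
theorem IsIrreducible.eq_smul_of_mulVec_eq [Nonempty n] {A : Matrix n n ℝ}
    (hA : A.IsIrreducible) {x y : n → ℝ} {r : ℝ} (hx : ∀ v, 0 < x v)
    (hAx : A.mulVec x = r • x) (hAy : A.mulVec y = r • y) : ∃ c : ℝ, y = c • x := by
  obtain ⟨B, hB, -, heig⟩ := hA.exists_pos_commute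
  -- With the minimal ratio as `c`, the vector `y - c • x` is nonnegative and zero at `w`. If it
  -- were nonzero, `B` would make it positive at `w`, yet `B` only rescales it.
  obtain ⟨w, hw⟩ := Finite.exists_min fun v => y v / x v
  refine ⟨y w / x w, ?_⟩
  by_contra hne
  have hz0 : y - (y w / x w) • x ≠ 0 := sub_ne_zero.2 hne
  obtain ⟨b, hb⟩ := heig (y - (y w / x w) • x) r (by
    rw [mulVec_sub, mulVec_smul, hAx, hAy, smul_sub, smul_comm])
  have hpos := mulVec_pos_of_pos hB (z := y - (y w / x w) • x)
    (fun v => by simpa using (le_div_iff₀ (hx v)).1 (hw v)) hz0 w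
  rw [hb] at hpos
  simp [div_mul_cancel₀ _ (hx w).ne'] at hpos

/-- The spectral radius of a nonnegative matrix with a positive eigenvector is the eigenvalue. -/
theorem toReal_spectralRadius_eq [Nonempty n] {A : Matrix n n ℝ} (hA : ∀ i j, 0 ≤ A i j)
    {x : n → ℝ} {r : ℝ} (hx : ∀ v, 0 < x v) (hAx : A.mulVec x = r • x) :
    (spectralRadius ℂ (A.map fun a : ℝ => (a : ℂ))).toReal = r := by
  have hAx' : ∀ v, ∑ w, A v w * x w = r * x v := fun v => congrFun hAx v
  have hr : 0 ≤ r := by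
    obtain ⟨v⟩ := ‹Nonempty n›
    have h0 : 0 ≤ r * x v :=
      hAx' v ▸ Finset.sum_nonneg fun w _ => mul_nonneg (hA v w) (hx w).le
    exact nonneg_of_mul_nonneg_left h0 (hx v)
  have hspec : ∀ μ : ℂ, μ ∈ spectrum ℂ (A.map fun a : ℝ => (a : ℂ)) ↔
      ∃ z : n → ℂ, z ≠ 0 ∧ (A.map fun a : ℝ => (a : ℂ)).mulVec z = μ • z := by
    intro μ
    rw [← Matrix.spectrum_toLin', ← Module.End.hasEigenvalue_iff_mem_spectrum]
    constructor
    · intro h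
      obtain ⟨z, hz⟩ := h.exists_hasEigenvector
      exact ⟨z, hz.2, by simpa using hz.apply_eq_smul⟩
    · rintro ⟨z, hz0, hz⟩
      exact Module.End.hasEigenvalue_of_hasEigenvector
        ⟨Module.End.mem_eigenspace_iff.2 (by simpa using hz), hz0⟩
  have key : spectralRadius ℂ (A.map fun a : ℝ => (a : ℂ)) = ENNReal.ofReal r := by
    refine le_antisymm (iSup₂_le fun μ hμ => ?_) ?_
    · obtain ⟨z, hz0, hz⟩ := (hspec μ).1 hμ
      -- Measured against `x`, the eigenvector `z` is largest at `w`. The eigenvalue equation in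
      -- that coordinate bounds `‖μ‖` by `r`.
      obtain ⟨w, hw⟩ := Finite.exists_max fun v => ‖z v‖ / x v
      have hle : ∀ v, ‖z v‖ ≤ ‖z w‖ / x w * x v := fun v => (div_le_iff₀ (hx v)).1 (hw v)
      have hzw : 0 < ‖z w‖ := by
        rw [norm_pos_iff]
        intro h0
        refine hz0 (funext fun v => ?_)
        have := hle v
        rw [h0] at this
        simpa using this
      have h1 : ‖μ‖ * ‖z w‖ ≤ r * ‖z w‖ := by
        calc ‖μ‖ * ‖z w‖ = ‖(μ • z) w‖ := by simp
          _ = ‖∑ v, (A w v : ℂ) * z v‖ := by rw [← hz]; rfl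
          _ ≤ ∑ v, ‖(A w v : ℂ) * z v‖ := norm_sum_le _ _
          _ ≤ ∑ v, A w v * (‖z w‖ / x w * x v) := Finset.sum_le_sum fun v _ => by
              rw [norm_mul, Complex.norm_real, Real.norm_of_nonneg (hA w v)]
              exact mul_le_mul_of_nonneg_left (hle v) (hA w v)
          _ = ‖z w‖ / x w * ∑ v, A w v * x v := by
              rw [Finset.mul_sum]; exact Finset.sum_congr rfl fun v _ => by ring
          _ = r * ‖z w‖ := by rw [hAx' w]; field_simp [(hx w).ne']
      have h2 : ‖μ‖ ≤ r := le_of_mul_le_mul_right h1 hzw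
      rw [← enorm_eq_nnnorm, ← ofReal_norm]
      exact ENNReal.ofReal_le_ofReal h2
    · have hmem : (r : ℂ) ∈ spectrum ℂ (A.map fun a : ℝ => (a : ℂ)) := by
        refine (hspec _).2 ⟨fun v => (x v : ℂ), fun h0 => ?_, funext fun v => ?_⟩
        · obtain ⟨v⟩ := ‹Nonempty n›
          have := congrFun h0 v
          simp only [Pi.zero_apply, Complex.ofReal_eq_zero] at this
          exact (hx v).ne' this
        · have := congrArg (fun a : ℝ => (a : ℂ)) (hAx' v)
          simpa [mulVec, dotProduct] using this
      refine le_trans (le_of_eq ?_) (le_iSup₂ (f := fun (k : ℂ) (_ : k ∈ _) => (‖k‖₊ : ENNReal))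
        (r : ℂ) hmem)
      rw [← enorm_eq_nnnorm, ← ofReal_norm, Complex.norm_real, Real.norm_of_nonneg hr]
  rw [key, ENNReal.toReal_ofReal hr]

end Matrix

/-! ## Finite and infinite paths of Bratteli diagrams -/

namespace BratteliDiagram

variable {B : BratteliDiagram.{u}}

instance instFiniteEdge (n : ℕ) (p : B.V n) (q : B.V (n + 1)) : Finite (B.E n p q) :=
  B.finite_E n p q

instance instFiniteVertex (n : ℕ) : Finite (B.V n) := B.finite_V n

noncomputable instance instFintypeExt (γ : B.FinPath) : Fintype γ.Ext := Fintype.ofFinite _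

@[elab_as_elim]
theorem FinPath.induction {P : B.FinPath → Prop} (vertex : ∀ v, P (.vertex v))
    (snoc : ∀ (γ : B.FinPath) (e : γ.Ext), P γ → P (γ.snoc e.2)) (γ : B.FinPath) : P γ := by
  obtain ⟨n, p, γ⟩ := γ
  induction γ with
  | vertex v => exact vertex v
  | @snoc n p q γ e ih => exact snoc ⟨n, p, γ⟩ ⟨q, e⟩ ih

theorem FinPath.snoc_injective (γ : B.FinPath) {e e' : γ.Ext}
    (h : γ.snoc e.2 = γ.snoc e'.2) : e = e' := by
  obtain ⟨q, e⟩ := e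
  obtain ⟨q', e'⟩ := e'
  simp only [FinPath.snoc, FinPath.mk.injEq, true_and] at h
  obtain ⟨rfl, h⟩ := h
  have h' := eq_of_heq h
  injection h' with _ _ _ _ h'
  rw [h']

theorem FinPath.eq_of_snoc_eq {γ γ' : B.FinPath} {e : γ.Ext} {e' : γ'.Ext}
    (h : γ.snoc e.2 = γ'.snoc e'.2) : γ = γ' := by
  obtain ⟨n, p, γ⟩ := γ
  obtain ⟨n', p', γ'⟩ := γ'
  obtain ⟨q, e⟩ := e
  obtain ⟨q', e'⟩ := e'
  simp only [FinPath.snoc, FinPath.mk.injEq, Nat.add_right_cancel_iff] at h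
  obtain ⟨rfl, h, h'⟩ := h
  obtain rfl := eq_of_heq h
  have h'' := eq_of_heq h'
  injection h'' with _ h1 _ h2
  subst h1
  rw [eq_of_heq h2]

theorem FinPath.exists_eq_snoc {γ : B.FinPath} {n : ℕ} (h : γ.len = n + 1) :
    ∃ (η : B.FinPath) (e : η.Ext), η.len = n ∧ γ = η.snoc e.2 := by
  induction γ using FinPath.induction with
  | vertex v => exact absurd h (Nat.succ_ne_zero n).symm
  | snoc η e _ => exact ⟨η, e, Nat.succ_injective h, rfl⟩

theorem FinPath.exists_eq_vertex {γ : B.FinPath} (h : γ.len = 0) : ∃ v, γ = .vertex v := by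
  induction γ using FinPath.induction with
  | vertex v => exact ⟨v, rfl⟩
  | snoc η e _ => exact absurd h (Nat.succ_ne_zero _)

instance instFiniteLen (n : ℕ) : Finite {γ : B.FinPath // γ.len = n} := by
  induction n with
  | zero =>
    refine Finite.of_surjective
      (fun v : B.V 0 => (⟨.vertex v, rfl⟩ : {γ : B.FinPath // γ.len = 0})) ?_
    rintro ⟨γ, h⟩
    obtain ⟨v, rfl⟩ := FinPath.exists_eq_vertex h
    exact ⟨v, rfl⟩
  | succ n ih =>
    refine Finite.of_surjective
      (fun p : (Σ γ : {γ : B.FinPath // γ.len = n}, γ.1.Ext) =>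
        (⟨p.1.1.snoc p.2.2, congrArg (· + 1) p.1.2⟩ : {γ : B.FinPath // γ.len = n + 1})) ?_
    rintro ⟨γ, h⟩
    obtain ⟨η, e, hη, rfl⟩ := FinPath.exists_eq_snoc h
    exact ⟨⟨⟨η, hη⟩, e⟩, rfl⟩

theorem finite_len_eq (n : ℕ) : {γ : B.FinPath | γ.len = n}.Finite :=
  haveI : Finite ↑{γ : B.FinPath | γ.len = n} := instFiniteLen n
  Set.toFinite _

theorem finite_len_lt (n : ℕ) : {γ : B.FinPath | γ.len < n}.Finite := by
  have h : {γ : B.FinPath | γ.len < n} = ⋃ m ∈ Set.Iio n, {γ : B.FinPath | γ.len = m} := by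
    ext γ; simp
  rw [h]
  exact (Set.finite_Iio n).biUnion fun m _ => finite_len_eq m

instance instCountableFinPath : Countable B.FinPath := by
  have h : (Set.univ : Set B.FinPath) = ⋃ n, {γ : B.FinPath | γ.len = n} := by ext; simp
  exact Set.countable_univ_iff.1 (h ▸ Set.countable_iUnion fun n => (finite_len_eq n).countable)

theorem InfPath.trunc_succ (x : B.InfPath) (n : ℕ) :
    x.trunc (n + 1) = (x.trunc n).snoc (x.edge n) := rfl

theorem InfPath.trunc_eq_of_le {x y : B.InfPath} {m n : ℕ} (hmn : m ≤ n)
    (h : x.trunc n = y.trunc n) : x.trunc m = y.trunc m := by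
  induction n, hmn using Nat.le_induction with
  | base => exact h
  | succ n _ ih =>
    exact ih (FinPath.eq_of_snoc_eq (e := ⟨_, x.edge n⟩) (e' := ⟨_, y.edge n⟩) h)

theorem InfPath.isSubpath_trunc (x : B.InfPath) {m n : ℕ} (h : m ≤ n) :
    (x.trunc m).IsSubpath (x.trunc n) := by
  induction n, h using Nat.le_induction with
  | base => exact .refl
  | succ n _ ih => exact .snoc ih _

theorem mem_cylinder {x : B.InfPath} {γ : B.FinPath} : x ∈ cylinder γ ↔ x.trunc γ.len = γ :=
  Iff.rfl

theorem InfPath.mem_cylinder_trunc (x : B.InfPath) (n : ℕ) : x ∈ cylinder (x.trunc n) :=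
  rfl

theorem cylinder_snoc_subset (γ : B.FinPath) (e : γ.Ext) :
    cylinder (γ.snoc e.2) ⊆ cylinder γ := fun x hx =>
  FinPath.eq_of_snoc_eq (e := ⟨_, x.edge γ.len⟩) (e' := e) hx

theorem exists_mem_cylinder_snoc {γ : B.FinPath} {x : B.InfPath} (hx : x ∈ cylinder γ) :
    ∃ e : γ.Ext, x ∈ cylinder (γ.snoc e.2) := by
  obtain ⟨n, p, γ⟩ := γ
  have h1 : x.trunc n = ⟨n, p, γ⟩ := hx
  rw [← h1]
  exact ⟨⟨_, x.edge n⟩, rfl⟩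

theorem eq_of_mem_cylinder {γ η : B.FinPath} {x : B.InfPath} (hγ : x ∈ cylinder γ)
    (hη : x ∈ cylinder η) (h : γ.len = η.len) : γ = η := by
  rw [← mem_cylinder.1 hγ, ← mem_cylinder.1 hη, h]

theorem ext_eq_of_mem_cylinder {γ : B.FinPath} {e e' : γ.Ext} {x : B.InfPath}
    (h : x ∈ cylinder (γ.snoc e.2)) (h' : x ∈ cylinder (γ.snoc e'.2)) : e = e' :=
  γ.snoc_injective (eq_of_mem_cylinder h h' rfl)

/-- Two cylinder sets that meet are nested. -/
theorem cylinder_subset_of_mem {γ η : B.FinPath} {x : B.InfPath} (hγ : x ∈ cylinder γ)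
    (hη : x ∈ cylinder η) (h : γ.len ≤ η.len) : cylinder η ⊆ cylinder γ := fun y hy => by
  have h1 : y.trunc η.len = x.trunc η.len := hy.trans hη.symm
  exact (InfPath.trunc_eq_of_le h h1).trans hγ

end BratteliDiagram

namespace KGraph

variable {k : ℕ} {Λ : KGraph.{u} k}

/-! ## Factorizations -/

/-- Uniqueness of factorizations, asking only that the first factors have equal degree: cancellation
in `ℕ^k` gives the second. -/
theorem comp_inj {f g f' g' : Λ.Mor} {h : Λ.s f = Λ.r g} {h' : Λ.s f' = Λ.r g'}
    (heq : Λ.comp f g h = Λ.comp f' g' h') (hd : Λ.deg f = Λ.deg f') : f = f' ∧ g = g' := by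
  have h1 := Λ.deg_comp f g h
  have h2 := Λ.deg_comp f' g' h'
  have hg : Λ.deg g = Λ.deg g' := by
    rw [heq, h2, hd] at h1
    exact (add_left_cancel h1).symm
  have hu := (Λ.factorization _ _ _ h1).unique (y₁ := (f, g)) (y₂ := (f', g'))
    ⟨rfl, rfl, h, rfl⟩ ⟨hd.symm, hg.symm, h', heq.symm⟩
  exact ⟨congrArg Prod.fst hu, congrArg Prod.snd hu⟩

theorem exists_comp {f : Λ.Mor} {m n : Fin k → ℕ} (h : Λ.deg f = m + n) :
    ∃ (a b : Λ.Mor) (hab : Λ.s a = Λ.r b), Λ.deg a = m ∧ Λ.deg b = n ∧ Λ.comp a b hab = f := by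
  obtain ⟨⟨a, b⟩, ⟨h1, h2, h3, h4⟩, -⟩ := Λ.factorization f m n h
  exact ⟨a, b, h3, h1, h2, h4⟩

/-- `1 f` and `f 1` are two factorizations of `f` with first factors of degree zero, so those
factors agree. -/
theorem eq_one_of_deg_eq_zero {f : Λ.Mor} (h : Λ.deg f = 0) : f = Λ.one (Λ.r f) :=
  (comp_inj ((Λ.one_comp f).trans (Λ.comp_one f).symm) ((Λ.deg_one _).trans h.symm)).1.symm

/-- `f` is an initial segment of `g`. -/
def IsInitial (f g : Λ.Mor) : Prop := ∃ (c : Λ.Mor) (h : Λ.s f = Λ.r c), Λ.comp f c h = g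

theorem IsInitial.refl (f : Λ.Mor) : IsInitial f f := ⟨_, _, Λ.comp_one f⟩

theorem isInitial_comp (f g : Λ.Mor) (h : Λ.s f = Λ.r g) : IsInitial f (Λ.comp f g h) :=
  ⟨g, h, rfl⟩

theorem IsInitial.trans {f g h : Λ.Mor} (hfg : IsInitial f g) (hgh : IsInitial g h) :
    IsInitial f h := by
  obtain ⟨c, hc, rfl⟩ := hfg
  obtain ⟨d, hd, rfl⟩ := hgh
  exact ⟨Λ.comp c d ((Λ.s_comp _ _ _).symm.trans hd), hc.trans (Λ.r_comp _ _ _).symm,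
    (Λ.assoc _ _ _ _ _).symm⟩

theorem IsInitial.eq_of_deg_eq {f g h : Λ.Mor} (hf : IsInitial f h) (hg : IsInitial g h)
    (hd : Λ.deg f = Λ.deg g) : f = g := by
  obtain ⟨c, hc, rfl⟩ := hf
  obtain ⟨d, hd', h2⟩ := hg
  exact (comp_inj h2.symm hd).1

theorem exists_isInitial {f : Λ.Mor} {m : Fin k → ℕ} (h : m ≤ Λ.deg f) :
    ∃ g, Λ.deg g = m ∧ IsInitial g f := by
  obtain ⟨a, b, hab, ha, -, rfl⟩ := exists_comp (add_tsub_cancel_of_le h).symm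
  exact ⟨a, ha, isInitial_comp _ _ _⟩

/-- The initial segment of `g` of degree `deg f` and `f` itself are initial segments of `h` of equal
degree. -/
theorem IsInitial.of_deg_le {f g h : Λ.Mor} (hf : IsInitial f h) (hg : IsInitial g h)
    (hd : Λ.deg f ≤ Λ.deg g) : IsInitial f g := by
  obtain ⟨f', hf', hf'g⟩ := exists_isInitial hd
  obtain rfl := (hf'g.trans hg).eq_of_deg_eq hf hf'
  exact hf'g

theorem InfPath.isInitial_mor (x : Λ.InfPath) {m n : Fin k → ℕ} (h : m ≤ n) :
    IsInitial (x.mor 0 m zero_le) (x.mor 0 n zero_le) :=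
  ⟨_, _, x.mor_comp 0 m n zero_le h⟩

theorem InfPath.mem_cylinder_iff (x : Λ.InfPath) (f : Λ.Mor) :
    x ∈ cylinder f ↔ x.mor 0 (Λ.deg f) zero_le = f := Iff.rfl

/-- Allows cylinder sets of different degrees to be compared at one common degree `n`. -/
theorem InfPath.mem_cylinder_iff_isInitial (x : Λ.InfPath) {f : Λ.Mor} {n : Fin k → ℕ}
    (h : Λ.deg f ≤ n) : x ∈ cylinder f ↔ IsInitial f (x.mor 0 n zero_le) := by
  refine ⟨fun hx => ?_, fun hf => ?_⟩
  · have := x.isInitial_mor h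
    rwa [(x.mem_cylinder_iff f).1 hx] at this
  · exact (x.isInitial_mor h).eq_of_deg_eq hf (by rw [x.deg_mor, tsub_zero])

/-! ## The vertices, edges and finite paths of the diagram -/

instance instFiniteColorEdge [hΛ : Λ.IsFinite] (i : Fin k) (v w : Λ.Obj) :
    Finite (Λ.ColorEdge i v w) :=
  ((hΛ.finite_deg (Pi.single i 1)).subset (fun _ hf => hf.1)).to_subtype

theorem rainbow_zero (k : ℕ) : rainbow k 0 = 0 := by
  funext i; simp [rainbow]

theorem rainbow_mul (k n : ℕ) [NeZero k] : rainbow k (n * k) = fun _ => n := by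
  funext i; simp [rainbow, NeZero.ne k]

theorem exists_le_rainbow {k : ℕ} [NeZero k] (n : Fin k → ℕ) : ∃ N, n ≤ rainbow k N := by
  -- A path of length `q * k` has degree `(q, …, q)`, and the sum of the coordinates of `n` bounds
  -- each of them.
  refine ⟨(∑ i, n i) * k, fun i => ?_⟩
  rw [rainbow_mul]
  exact Finset.single_le_sum (fun _ _ => Nat.zero_le _) (Finset.mem_univ i)

variable [NeZero k] [Λ.IsFinite]

/-- The product of the edges of a finite path of the diagram, with its degree and source. -/
def pathMorAux : {n : ℕ} → {p : Λ.bratteli.V n} → Λ.bratteli.Path n p →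
    {f : Λ.Mor // Λ.deg f = rainbow k n ∧ Λ.s f = p}
  | _, _, .vertex v => ⟨Λ.one v, (Λ.deg_one v).trans (rainbow_zero k).symm, Λ.s_one v⟩
  | _, _, .snoc γ e => ⟨Λ.comp (pathMorAux γ).1 e.1 ((pathMorAux γ).2.2.trans e.2.2.1.symm),
      by rw [Λ.deg_comp, (pathMorAux γ).2.1, e.2.1, rainbow_succ],
      by rw [Λ.s_comp, e.2.2.2]⟩

/-- The product of the edges of a finite path of the diagram. -/
def pathMor (γ : Λ.bratteli.FinPath) : Λ.Mor := (pathMorAux γ.path).1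

theorem deg_pathMor (γ : Λ.bratteli.FinPath) : Λ.deg (pathMor γ) = rainbow k γ.len :=
  (pathMorAux γ.path).2.1

theorem s_pathMor (γ : Λ.bratteli.FinPath) : Λ.s (pathMor γ) = γ.src :=
  (pathMorAux γ.path).2.2

theorem pathMor_vertex (v : Λ.bratteli.V 0) : pathMor (.vertex v) = Λ.one v := rfl

theorem pathMor_snoc (γ : Λ.bratteli.FinPath) (e : γ.Ext) :
    pathMor (γ.snoc e.2) = Λ.comp (pathMor γ) e.2.1 ((s_pathMor γ).trans e.2.2.2.1.symm) := rfl

/-- The length fixes the degree of a path without its last edge, so `comp_inj` peels off edges one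
at a time. -/
theorem pathMor_injective {γ η : Λ.bratteli.FinPath} (h : pathMor γ = pathMor η)
    (hl : γ.len = η.len) : γ = η := by
  induction γ using BratteliDiagram.FinPath.induction generalizing η with
  | vertex v =>
    obtain ⟨w, rfl⟩ := BratteliDiagram.FinPath.exists_eq_vertex hl.symm
    rw [pathMor_vertex, pathMor_vertex] at h
    have hvw : v = w := (Λ.r_one v).symm.trans ((congrArg Λ.r h).trans (Λ.r_one w))
    rw [hvw]
  | snoc γ e ih =>
    obtain ⟨η, e', hη, rfl⟩ := BratteliDiagram.FinPath.exists_eq_snoc hl.symm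
    rw [pathMor_snoc, pathMor_snoc] at h
    obtain ⟨h1, h2⟩ := comp_inj h (by rw [deg_pathMor, deg_pathMor, hη])
    obtain rfl := ih h1 hη.symm
    obtain ⟨q, e⟩ := e
    obtain ⟨q', e'⟩ := e'
    obtain rfl : q = q' := by rw [← e.2.2.2, ← e'.2.2.2, h2]
    obtain rfl : e = e' := Subtype.ext h2
    rfl

/-- By `rainbow_succ` the degree grows by one color per level, so the morphism factors one edge at a
time from the end. -/
theorem exists_pathMor_eq {n : ℕ} {f : Λ.Mor} (hf : Λ.deg f = rainbow k n) :
    ∃ γ : Λ.bratteli.FinPath, γ.len = n ∧ pathMor γ = f := by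
  induction n generalizing f with
  | zero =>
    rw [rainbow_zero] at hf
    exact ⟨.vertex (Λ.r f), rfl, (eq_one_of_deg_eq_zero hf).symm⟩
  | succ n ih =>
    obtain ⟨a, b, hab, ha, hb, rfl⟩ := exists_comp (hf.trans (rainbow_succ k n))
    obtain ⟨γ, rfl, rfl⟩ := ih ha
    exact ⟨γ.snoc (q := Λ.s b) ⟨b, hb, by rw [← hab, s_pathMor], rfl⟩, rfl, rfl⟩

theorem InfPath.pathMor_trunc (x : Λ.InfPath) (n : ℕ) :
    pathMor (x.toBratteli.trunc n) = x.mor 0 (rainbow k n) zero_le := by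
  induction n with
  | zero =>
    have h : ∀ (m : Fin k → ℕ) (hm : m = 0), Λ.one (x.obj m) = x.mor 0 m zero_le := by
      rintro m rfl
      exact (x.mor_self 0).symm
    exact h _ (rainbow_zero k)
  | succ n ih =>
    have h := pathMor_snoc (x.toBratteli.trunc n) ⟨_, x.toBratteli.edge n⟩
    rw [BratteliDiagram.InfPath.trunc_succ]
    refine h.trans ?_
    rw [← x.mor_comp 0 (rainbow k n) (rainbow k (n + 1)) zero_le (rainbow_le_succ k n)]
    congr 1

theorem mem_pathCylinder_iff {x : Λ.InfPath} {γ : Λ.bratteli.FinPath} :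
    x ∈ pathCylinder γ ↔ x.mor 0 (rainbow k γ.len) zero_le = pathMor γ := by
  rw [← x.pathMor_trunc]
  exact ⟨fun h => congrArg pathMor h, fun h => pathMor_injective h rfl⟩

theorem pathCylinder_eq_cylinder (γ : Λ.bratteli.FinPath) :
    pathCylinder γ = cylinder (pathMor γ) := by
  ext x
  rw [mem_pathCylinder_iff, InfPath.mem_cylinder_iff]
  simp only [deg_pathMor]

theorem isInitial_pathMor_snoc (γ : Λ.bratteli.FinPath) (e : γ.Ext) :
    IsInitial (pathMor γ) (pathMor (γ.snoc e.2)) :=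
  isInitial_comp _ _ _

end KGraph

namespace KGraph

variable {k : ℕ} {Λ : KGraph.{u} k}

/-! ## The Perron–Frobenius eigenvector -/

theorem adj_nonneg (i : Fin k) (v w : Λ.Obj) : 0 ≤ Λ.adj i v w := Nat.cast_nonneg _

variable [Λ.IsFinite]

/-- Unique factorization turns composable pairs of edges of colors `i`, `j` into morphisms of degree
`e_i + e_j`. That count is symmetric in `i` and `j`, which is why the adjacency matrices commute. -/
theorem sum_adj_mul_adj (i j : Fin k) (v w : Λ.Obj) :
    (Λ.adj i * Λ.adj j) v w = (Nat.card {f : Λ.Mor //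
      Λ.deg f = Pi.single i 1 + Pi.single j 1 ∧ Λ.r f = v ∧ Λ.s f = w} : ℝ) := by
  have h : Nat.card (Σ u, Λ.ColorEdge i v u × Λ.ColorEdge j u w) = Nat.card {f : Λ.Mor //
      Λ.deg f = Pi.single i 1 + Pi.single j 1 ∧ Λ.r f = v ∧ Λ.s f = w} := by
    refine Nat.card_eq_of_bijective
      (fun p => ⟨Λ.comp p.2.1.1 p.2.2.1 (p.2.1.2.2.2.trans p.2.2.2.2.1.symm),
        by rw [Λ.deg_comp, p.2.1.2.1, p.2.2.2.1], by rw [Λ.r_comp, p.2.1.2.2.1],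
        by rw [Λ.s_comp, p.2.2.2.2.2]⟩) ⟨?_, ?_⟩
    · rintro ⟨u, ⟨e, he⟩, ⟨f, hf⟩⟩ ⟨u', ⟨e', he'⟩, ⟨f', hf'⟩⟩ h
      obtain ⟨rfl, rfl⟩ := comp_inj (congrArg Subtype.val h) (he.1.trans he'.1.symm)
      obtain rfl : u = u' := he.2.2.symm.trans he'.2.2
      rfl
    · rintro ⟨f, hd, hr, hs⟩
      obtain ⟨a, b, hab, ha, hb, rfl⟩ := exists_comp hd
      exact ⟨⟨Λ.s a, ⟨a, ha, (Λ.r_comp _ _ _).symm.trans hr, rfl⟩,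
        ⟨b, hb, hab.symm, (Λ.s_comp _ _ _).symm.trans hs⟩⟩, rfl⟩
  rw [← h, Nat.card_sigma]
  simp [Matrix.mul_apply, adj, Nat.card_prod]

theorem adj_commute (i j : Fin k) : Commute (Λ.adj i) (Λ.adj j) := by
  ext v w
  rw [sum_adj_mul_adj, sum_adj_mul_adj, add_comm]

theorem adj_commute_adjProd (i : Fin k) : Commute (Λ.adj i) Λ.adjProd :=
  Commute.list_prod_right _ _ fun B hB => by
    obtain ⟨j, rfl⟩ := (List.mem_ofFn' _ _).1 hB
    exact adj_commute i j

/-- Each `A_i` commutes with `A`, so it maps the Perron eigenvector `x` of `A` into the same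
eigenspace, which is a line. The resulting eigenvalue is the spectral radius of `A_i` because `x` is
positive. -/
theorem exists_isPerronFrobenius [Nonempty Λ.Obj] (hirr : Λ.adjProd.IsIrreducible) :
    ∃ x, Λ.IsPerronFrobenius x := by
  obtain ⟨x, r, hx, hx1, hAx⟩ := hirr.exists_pos_eigenvector
  refine ⟨x, hx, hx1, fun i => ?_⟩
  obtain ⟨c, hc⟩ := hirr.eq_smul_of_mulVec_eq (y := (Λ.adj i).mulVec x) hx hAx (by
    rw [Matrix.mulVec_mulVec, ← (adj_commute_adjProd i).eq, ← Matrix.mulVec_mulVec, hAx,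
      Matrix.mulVec_smul])
  rw [hc, rho, Matrix.toReal_spectralRadius_eq (adj_nonneg i) hx hc]

theorem isPerronFrobenius_perron [Nonempty Λ.Obj] (hirr : Λ.adjProd.IsIrreducible) :
    Λ.IsPerronFrobenius Λ.perron := by
  have h := exists_isPerronFrobenius hirr
  rw [perron, dif_pos h]
  exact h.choose_spec

/-- If `ρ_i` were zero, the positive vector in the kernel of `A_i` would force `A_i = 0`, hence `A =
0`, which is not irreducible. -/
theorem rho_pos [Nonempty Λ.Obj] (hirr : Λ.adjProd.IsIrreducible) (i : Fin k) :
    0 < Λ.rho i := by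
  refine lt_of_le_of_ne ENNReal.toReal_nonneg fun h0 => ?_
  obtain ⟨x, hx⟩ := exists_isPerronFrobenius hirr
  have h1 := hx.eigen i
  rw [← h0, zero_smul] at h1
  have hi : Λ.adj i = 0 := by
    ext v w
    have h2 : ∑ u, Λ.adj i v u * x u = 0 := congrFun h1 v
    rw [Finset.sum_eq_zero_iff_of_nonneg
      fun u _ => mul_nonneg (adj_nonneg i v u) (hx.pos u).le] at h2
    exact (mul_eq_zero.1 (h2 w (Finset.mem_univ w))).resolve_right (hx.pos w).ne'
  have hA : Λ.adjProd = 0 :=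
    List.prod_eq_zero (hi ▸ (List.mem_ofFn' _ _).2 ⟨i, rfl⟩)
  obtain ⟨v⟩ := ‹Nonempty Λ.Obj›
  obtain ⟨m, hm, hpos⟩ :=
    (Matrix.isIrreducible_iff_exists_pow_pos hirr.nonneg).1 hirr v v
  rw [hA, zero_pow hm.ne'] at hpos
  simp at hpos

theorem rhoPow_pos (hρ : ∀ i, 0 < Λ.rho i) (n : Fin k → ℕ) : 0 < Λ.rhoPow n :=
  Finset.prod_pos fun i _ => pow_pos (hρ i) _

theorem rhoPow_zero : Λ.rhoPow 0 = 1 := by simp [rhoPow]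

theorem rhoPow_add (m n : Fin k → ℕ) : Λ.rhoPow (m + n) = Λ.rhoPow m * Λ.rhoPow n := by
  simp [rhoPow, pow_add, Finset.prod_mul_distrib]

theorem rhoPow_single (i : Fin k) : Λ.rhoPow (Pi.single i 1) = Λ.rho i := by
  rw [rhoPow, Finset.prod_eq_single i] <;> simp +contextual

/-- The edges of color `i` with range `v`. -/
abbrev EdgesFrom (Λ : KGraph.{u} k) (i : Fin k) (v : Λ.Obj) : Type u :=
  Σ w : Λ.Obj, Λ.ColorEdge i v w

noncomputable instance instFintypeColorEdge (i : Fin k) (v w : Λ.Obj) :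
    Fintype (Λ.ColorEdge i v w) := Fintype.ofFinite _

/-- The eigenvalue equation counted edge by edge. It makes the transition probabilities sum to one
and the cylinder formula additive. -/
theorem IsPerronFrobenius.sum_edgesFrom {x : Λ.Obj → ℝ} (hx : Λ.IsPerronFrobenius x)
    (i : Fin k) (v : Λ.Obj) : ∑ e : Λ.EdgesFrom i v, x e.1 = Λ.rho i * x v := by
  have h1 : ∑ w, Λ.adj i v w * x w = Λ.rho i * x v := congrFun (hx.eigen i) v
  rw [← h1]
  rw [Fintype.sum_sigma]
  simp [adj, Nat.card_eq_fintype_card]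

end KGraph

/-! ### Splitting a cylinder set along the edges of one color -/

namespace KGraph

variable {k : ℕ} {Λ : KGraph.{u} k}

theorem comp_eq_of_deg_eq_zero {a c : Λ.Mor} (ha : Λ.deg a = 0) (h : Λ.s a = Λ.r c) :
    Λ.comp a c h = c := by
  obtain ⟨v, rfl⟩ : ∃ v, a = Λ.one v := ⟨_, eq_one_of_deg_eq_zero ha⟩
  obtain rfl : v = Λ.r c := (Λ.s_one v).symm.trans h
  exact Λ.one_comp c

theorem cylinder_eq_iUnion_edgesFrom (f : Λ.Mor) (i : Fin k) :
    cylinder f = ⋃ e : Λ.EdgesFrom i (Λ.s f), cylinder (Λ.comp f e.2.1 e.2.2.2.1.symm) := by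
  ext x
  rw [Set.mem_iUnion]
  constructor
  · intro hx
    have hle : Λ.deg f ≤ Λ.deg f + Pi.single i 1 := le_self_add
    have hx' : x.mor 0 (Λ.deg f) zero_le = f := hx
    refine ⟨⟨_, x.mor _ _ hle, by rw [x.deg_mor, add_tsub_cancel_left],
      by rw [x.r_mor, ← x.s_mor 0 _ zero_le, hx'], rfl⟩, ?_⟩
    rw [x.mem_cylinder_iff_isInitial
      (n := Λ.deg f + Pi.single i 1) (by rw [Λ.deg_comp, x.deg_mor, add_tsub_cancel_left])]
    rw [← x.mor_comp 0 _ _ zero_le hle]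
    simp only [hx']
    exact .refl _
  · rintro ⟨e, he⟩
    have hle : Λ.deg f ≤ Λ.deg (Λ.comp f e.2.1 e.2.2.2.1.symm) := by
      rw [Λ.deg_comp]; exact le_self_add
    rw [x.mem_cylinder_iff_isInitial hle]
    rw [x.mem_cylinder_iff] at he
    rw [he]
    exact isInitial_comp _ _ _

theorem pairwise_disjoint_cylinder_comp (f : Λ.Mor) (i : Fin k) :
    Pairwise (Function.onFun Disjoint
      fun e : Λ.EdgesFrom i (Λ.s f) => cylinder (Λ.comp f e.2.1 e.2.2.2.1.symm)) := by
  rintro ⟨w, e, he⟩ ⟨w', e', he'⟩ hne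
  refine Set.disjoint_left.2 fun x hx hx' => hne ?_
  have h1 : x.mor 0 _ zero_le = Λ.comp f e he.2.1.symm := hx
  have h2 : x.mor 0 _ zero_le = Λ.comp f e' he'.2.1.symm := hx'
  have hd : Λ.deg (Λ.comp f e he.2.1.symm) = Λ.deg (Λ.comp f e' he'.2.1.symm) := by
    rw [Λ.deg_comp, Λ.deg_comp, he.1, he'.1]
  simp only [hd] at h1
  obtain ⟨-, rfl⟩ := comp_inj (h1.symm.trans h2) rfl
  obtain rfl : w = w' := he.2.2.symm.trans he'.2.2
  rfl

variable [NeZero k] [Λ.IsFinite]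

/-! ## Infinite paths of the `k`-graph from infinite paths of the diagram -/

theorem isInitial_pathMor_trunc (y : Λ.bratteli.InfPath) {m n : ℕ} (h : m ≤ n) :
    IsInitial (pathMor (y.trunc m)) (pathMor (y.trunc n)) := by
  induction n, h using Nat.le_induction with
  | base => exact .refl _
  | succ n _ ih => exact ih.trans (isInitial_pathMor_snoc (y.trunc n) ⟨_, y.edge n⟩)

theorem exists_initialMor (y : Λ.bratteli.InfPath) (n : Fin k → ℕ) :
    ∃ f : Λ.Mor, Λ.deg f = n ∧ ∃ N, IsInitial f (pathMor (y.trunc N)) := by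
  obtain ⟨N, hN⟩ := exists_le_rainbow n
  have hd : Λ.deg (pathMor (y.trunc N)) = rainbow k N := deg_pathMor _
  obtain ⟨f, hf, hfi⟩ := exists_isInitial (hN.trans hd.ge)
  exact ⟨f, hf, N, hfi⟩

/-- The initial segment of degree `n` of an infinite path of the diagram. -/
noncomputable def initialMor (y : Λ.bratteli.InfPath) (n : Fin k → ℕ) : Λ.Mor :=
  (exists_initialMor y n).choose

theorem deg_initialMor (y : Λ.bratteli.InfPath) (n : Fin k → ℕ) :
    Λ.deg (initialMor y n) = n := (exists_initialMor y n).choose_spec.1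

theorem exists_isInitial_initialMor (y : Λ.bratteli.InfPath) (n : Fin k → ℕ) :
    ∃ N, ∀ N', N ≤ N' → IsInitial (initialMor y n) (pathMor (y.trunc N')) := by
  obtain ⟨N, hN⟩ := (exists_initialMor y n).choose_spec.2
  exact ⟨N, fun N' h => hN.trans (isInitial_pathMor_trunc y h)⟩

theorem isInitial_initialMor (y : Λ.bratteli.InfPath) {m n : Fin k → ℕ} (h : m ≤ n) :
    IsInitial (initialMor y m) (initialMor y n) := by
  obtain ⟨M, hM⟩ := exists_isInitial_initialMor y m
  obtain ⟨N, hN⟩ := exists_isInitial_initialMor y n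
  exact (hM _ (le_max_left M N)).of_deg_le (hN _ (le_max_right M N))
    (by rwa [deg_initialMor, deg_initialMor])

/-- Shows that the choice in `initialMor` is harmless: along the diagram it returns the given path.
-/
theorem initialMor_rainbow (y : Λ.bratteli.InfPath) (n : ℕ) :
    initialMor y (rainbow k n) = pathMor (y.trunc n) := by
  obtain ⟨N, hN⟩ := exists_isInitial_initialMor y (rainbow k n)
  refine (hN _ (le_max_left N n)).eq_of_deg_eq
    (isInitial_pathMor_trunc y (le_max_right N n)) ?_
  rw [deg_initialMor, deg_pathMor]
  rfl

/-- The segment from `m` to `n` of an infinite path of the diagram. -/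
noncomputable def segment (y : Λ.bratteli.InfPath) (m n : Fin k → ℕ) (h : m ≤ n) : Λ.Mor :=
  (isInitial_initialMor y h).choose

theorem s_initialMor_eq (y : Λ.bratteli.InfPath) (m n : Fin k → ℕ) (h : m ≤ n) :
    Λ.s (initialMor y m) = Λ.r (segment y m n h) :=
  (isInitial_initialMor y h).choose_spec.choose

theorem initialMor_comp_segment (y : Λ.bratteli.InfPath) (m n : Fin k → ℕ) (h : m ≤ n) :
    Λ.comp (initialMor y m) (segment y m n h) (s_initialMor_eq y m n h) = initialMor y n :=
  (isInitial_initialMor y h).choose_spec.choose_spec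

theorem s_segment (y : Λ.bratteli.InfPath) (m n : Fin k → ℕ) (h : m ≤ n) :
    Λ.s (segment y m n h) = Λ.s (initialMor y n) := by
  rw [← initialMor_comp_segment y m n h, Λ.s_comp]

/-- The infinite path of `Λ` with a given sequence of edges in the diagram. -/
noncomputable def ofBratteli (y : Λ.bratteli.InfPath) : Λ.InfPath where
  obj n := Λ.s (initialMor y n)
  mor := segment y
  r_mor m n h := (s_initialMor_eq y m n h).symm
  s_mor := s_segment y
  -- This identity and `mor_comp` follow by composing with `initialMor y m` on the left and
  -- cancelling it.
  mor_self m :=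
    (comp_inj ((initialMor_comp_segment y m m le_rfl).trans (Λ.comp_one _).symm) rfl).2
  mor_comp m n p h h' := by
    refine (comp_inj (f := initialMor y m) (f' := initialMor y m)
      (h := (s_initialMor_eq y m n h).trans (Λ.r_comp _ _ _).symm)
      (h' := s_initialMor_eq y m p _) ?_ rfl).2
    rw [initialMor_comp_segment, ← Λ.assoc _ _ _ (s_initialMor_eq y m n h)]
    simp only [initialMor_comp_segment]
  deg_mor m n h := by
    have h1 := congrArg Λ.deg (initialMor_comp_segment y m n h)
    rw [Λ.deg_comp, deg_initialMor, deg_initialMor] at h1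
    funext i
    have h2 := congrFun h1 i
    simp only [Pi.add_apply, Pi.sub_apply] at h2 ⊢
    omega

theorem ofBratteli_mor_zero (y : Λ.bratteli.InfPath) (n : Fin k → ℕ) :
    (ofBratteli y).mor 0 n zero_le = initialMor y n := by
  rw [← initialMor_comp_segment y 0 n zero_le,
    comp_eq_of_deg_eq_zero (deg_initialMor y 0)]
  rfl

theorem ofBratteli_mem_pathCylinder {y : Λ.bratteli.InfPath} {γ : Λ.bratteli.FinPath} :
    ofBratteli y ∈ pathCylinder γ ↔ y ∈ BratteliDiagram.cylinder γ := by
  rw [mem_pathCylinder_iff, ofBratteli_mor_zero, initialMor_rainbow]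
  exact ⟨fun h => pathMor_injective h rfl, fun h => congrArg pathMor h⟩

/-! ## The Borel sets of the infinite path space -/

/-- Once `deg f ≤ rainbow k N`, the first `N` edges in the diagram decide membership in `[f]`. -/
theorem cylinder_eq_biUnion (f : Λ.Mor) :
    cylinder f = ⋃ γ ∈ {γ : Λ.bratteli.FinPath | pathCylinder γ ⊆ cylinder f},
      pathCylinder γ := by
  refine Set.Subset.antisymm (fun x hx => ?_) (Set.iUnion₂_subset fun γ hγ => hγ)
  obtain ⟨N, hN⟩ := exists_le_rainbow (Λ.deg f)
  refine Set.mem_biUnion (x := x.toBratteli.trunc N) (fun y hy => ?_)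
    (x.toBratteli.mem_cylinder_trunc N)
  rw [InfPath.mem_cylinder_iff_isInitial _ hN] at hx ⊢
  rwa [← InfPath.pathMor_trunc,
    show y.toBratteli.trunc N = x.toBratteli.trunc N from hy, InfPath.pathMor_trunc]

variable (Λ) in
-- A `k`-graph is countable, so the topology is second countable and its subbasis of cylinders
-- generates the Borel sets. Each of these is a countable union of path cylinders.
theorem measurableSpace_eq_generateFrom : instMeasInfPath Λ =
    MeasurableSpace.generateFrom (Set.range (pathCylinder (Λ := Λ))) := by
  have := Λ.countable
  have hc : (Set.range (cylinder (Λ := Λ))).Countable := Set.countable_range _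
  have : SecondCountableTopology Λ.InfPath := ⟨_, hc, rfl⟩
  refine le_antisymm ?_ (MeasurableSpace.generateFrom_le ?_)
  · rw [instMeasInfPath,
      borel_eq_generateFrom_of_subbasis (s := Set.range (cylinder (Λ := Λ))) rfl]
    refine MeasurableSpace.generateFrom_le ?_
    rintro _ ⟨f, rfl⟩
    rw [cylinder_eq_biUnion f]
    exact MeasurableSet.biUnion (Set.to_countable _) fun γ _ =>
      MeasurableSpace.measurableSet_generateFrom ⟨γ, rfl⟩
  · rintro _ ⟨γ, rfl⟩
    exact (isOpen_pathCylinder γ).measurableSet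

/-! ## The measure on the infinite path space -/

/-- The cylinder formula follows from its case for the degrees of paths of the diagram. -/
theorem apply_cylinder_of_apply_pathCylinder {x : Λ.Obj → ℝ} (hx : Λ.IsPerronFrobenius x)
    (hρ : ∀ i, 0 < Λ.rho i) {M : Measure Λ.InfPath}
    (hM : ∀ γ : Λ.bratteli.FinPath, M (pathCylinder γ)
      = ENNReal.ofReal ((Λ.rhoPow (rainbow k γ.len))⁻¹ * x γ.src)) (f : Λ.Mor) :
    M (cylinder f) = ENNReal.ofReal ((Λ.rhoPow (Λ.deg f))⁻¹ * x (Λ.s f)) := by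
  obtain ⟨N, hN⟩ := exists_le_rainbow (Λ.deg f)
  -- Downward induction: `d` counts the edges missing between `deg f` and the degree of a path of
  -- length `N`. With none missing, `f` is a path. Otherwise `[f]` is split along edges of a missing
  -- color, and the eigenvalue equation sums the pieces.
  obtain ⟨d, hd⟩ : ∃ d, d = ∑ i, (rainbow k N i - Λ.deg f i) := ⟨_, rfl⟩
  induction d generalizing f with
  | zero =>
    have heq : Λ.deg f = rainbow k N := by
      refine le_antisymm hN fun i => ?_
      have := (Finset.sum_eq_zero_iff.1 hd.symm) i (Finset.mem_univ i)
      exact Nat.sub_eq_zero_iff_le.1 this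
    obtain ⟨γ, rfl, rfl⟩ := exists_pathMor_eq heq
    rw [← pathCylinder_eq_cylinder, hM, deg_pathMor, s_pathMor]
  | succ d ih =>
    obtain ⟨i, hi⟩ : ∃ i, Λ.deg f i < rainbow k N i := by
      by_contra! hcon
      rw [Finset.sum_eq_zero fun i _ => Nat.sub_eq_zero_of_le (hcon i)] at hd
      omega
    have hle : Λ.deg f + Pi.single i 1 ≤ rainbow k N := by
      intro j
      by_cases hj : j = i
      · subst hj; simpa using hi
      · simpa [hj] using hN j
    have hsum : d = ∑ j, (rainbow k N j - (Λ.deg f + Pi.single i 1 : Fin k → ℕ) j) := by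
      have h1 : ∑ j, (rainbow k N j - Λ.deg f j)
          = ∑ j, (rainbow k N j - (Λ.deg f + Pi.single i 1 : Fin k → ℕ) j) +
            ∑ j, (Pi.single i 1 : Fin k → ℕ) j := by
        rw [← Finset.sum_add_distrib]
        refine Finset.sum_congr rfl fun j _ => ?_
        have := hle j
        simp only [Pi.add_apply] at this ⊢
        omega
      rw [Finset.sum_pi_single' i 1 Finset.univ] at h1
      simp at h1
      simp only [Pi.add_apply]
      omega
    have hnn : ∀ v, 0 ≤ (Λ.rhoPow (Λ.deg f + Pi.single i 1))⁻¹ * x v := fun v =>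
      mul_nonneg (inv_nonneg.2 (rhoPow_pos hρ _).le) (hx.pos v).le
    have hterm : ∀ e : Λ.EdgesFrom i (Λ.s f),
        M (cylinder (Λ.comp f e.2.1 e.2.2.2.1.symm))
          = ENNReal.ofReal ((Λ.rhoPow (Λ.deg f + Pi.single i 1))⁻¹ * x e.1) := by
      intro e
      have hde : Λ.deg (Λ.comp f e.2.1 e.2.2.2.1.symm) = Λ.deg f + Pi.single i 1 := by
        rw [Λ.deg_comp, e.2.2.1]
      rw [ih _ (hde ▸ hle) (by rw [hde]; exact hsum), hde, Λ.s_comp, e.2.2.2.2]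
    rw [cylinder_eq_iUnion_edgesFrom f i, measure_iUnion (pairwise_disjoint_cylinder_comp f i)
      fun e => (isOpen_cylinder _).measurableSet, tsum_fintype]
    simp only [hterm]
    rw [← ENNReal.ofReal_sum_of_nonneg fun e _ => hnn _, ← Finset.mul_sum, hx.sum_edgesFrom,
      rhoPow_add, rhoPow_single]
    congr 1
    field_simp [(hρ i).ne']

end KGraph

namespace KGraph

variable {k : ℕ} {Λ : KGraph.{u} k} [NeZero k] [Λ.IsFinite]

/-! ## Existence of the measure on the infinite path space -/

instance instMeasurableSpaceEdgesFrom (i : Fin k) (v : Λ.Obj) :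
    MeasurableSpace (Λ.EdgesFrom i v) := ⊤

/-- The transition probabilities from the vertex `v` along the edges of color `i`. -/
noncomputable def edgePMF {x : Λ.Obj → ℝ} (hx : Λ.IsPerronFrobenius x)
    (hρ : ∀ i, 0 < Λ.rho i) (i : Fin k) (v : Λ.Obj) : PMF (Λ.EdgesFrom i v) :=
  PMF.ofFintype (fun e => ENNReal.ofReal (x e.1 / (Λ.rho i * x v))) (by
    rw [← ENNReal.ofReal_sum_of_nonneg fun e _ =>
      div_nonneg (hx.pos _).le (mul_pos (hρ i) (hx.pos v)).le, ← Finset.sum_div,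
      hx.sum_edgesFrom, div_self (mul_pos (hρ i) (hx.pos v)).ne', ENNReal.ofReal_one])

variable (Λ) in
/-- A choice of an edge at each vertex of the diagram. -/
abbrev EdgeChoice : Type u := ∀ p : ℕ × Λ.Obj, Λ.EdgesFrom (Fin.ofNat k p.1) p.2

/-- The vertices of the path that follows a choice of edges. -/
def EdgeChoice.vert (ω : Λ.EdgeChoice) (v : Λ.Obj) : ℕ → Λ.Obj
  | 0 => v
  | n + 1 => (ω (n, ω.vert v n)).1

/-- The path of the diagram that follows a choice of edges. -/
def EdgeChoice.path (ω : Λ.EdgeChoice) (v : Λ.Obj) : Λ.bratteli.InfPath where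
  vert := ω.vert v
  edge n := (ω (n, ω.vert v n)).2

/-- The level and the source of a finite path. -/
def endpoint (γ : Λ.bratteli.FinPath) : ℕ × Λ.Obj := (γ.len, γ.src)

/-- An extension of a finite path, as an edge at its endpoint. -/
def extEdge {γ : Λ.bratteli.FinPath} (e : γ.Ext) :
    Λ.EdgesFrom (Fin.ofNat k (endpoint γ).1) (endpoint γ).2 := e

theorem EdgeChoice.path_mem_cylinder_snoc {ω : Λ.EdgeChoice} {v : Λ.Obj}
    {γ : Λ.bratteli.FinPath} {e : γ.Ext} :
    ω.path v ∈ BratteliDiagram.cylinder (γ.snoc e.2) ↔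
      ω.path v ∈ BratteliDiagram.cylinder γ ∧ ω (endpoint γ) = extEdge e := by
  have key : ω.path v ∈ BratteliDiagram.cylinder γ →
      (ω.path v ∈ BratteliDiagram.cylinder (γ.snoc e.2) ↔ ω (endpoint γ) = extEdge e) := by
    intro h
    obtain ⟨n, rfl⟩ : ∃ n, γ = (ω.path v).trunc n := ⟨_, h.symm⟩
    refine ⟨fun h' => ?_, fun h' => ?_⟩
    · exact BratteliDiagram.FinPath.snoc_injective _
        (e := (⟨_, (ω.path v).edge n⟩ : ((ω.path v).trunc n).Ext)) h'
    · have h2 : (⟨_, (ω.path v).edge n⟩ : ((ω.path v).trunc n).Ext) = e := h'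
      rw [← h2]
      rfl
  exact ⟨fun h => ⟨BratteliDiagram.cylinder_snoc_subset γ e h,
    (key (BratteliDiagram.cylinder_snoc_subset γ e h)).1 h⟩, fun h => (key h.1).2 h.2⟩

/-- The choices of edges that follow a finite path form a box. -/
theorem exists_box {x : Λ.Obj → ℝ} (hx : Λ.IsPerronFrobenius x) (hρ : ∀ i, 0 < Λ.rho i)
    (γ : Λ.bratteli.FinPath) :
    ∃ (v₀ : Λ.Obj) (s : Finset (ℕ × Λ.Obj))
      (t : ∀ p : ℕ × Λ.Obj, Set (Λ.EdgesFrom (Fin.ofNat k p.1) p.2)),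
      (∀ p ∈ s, p.1 < γ.len) ∧
      (∀ v (ω : Λ.EdgeChoice), ω.path v ∈ BratteliDiagram.cylinder γ ↔
        v = v₀ ∧ ω ∈ Set.pi (s : Set (ℕ × Λ.Obj)) t) ∧
      ENNReal.ofReal (x v₀) *
        ∏ p ∈ s, (edgePMF hx hρ (Fin.ofNat k p.1) p.2).toMeasure (t p)
        = ENNReal.ofReal ((Λ.rhoPow (rainbow k γ.len))⁻¹ * x γ.src) := by
  classical
  induction γ using BratteliDiagram.FinPath.induction with
  | vertex v₀ =>
    refine ⟨v₀, ∅, fun _ => ∅, by simp, fun v ω => ?_, ?_⟩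
    · simp only [Finset.coe_empty, Set.empty_pi, Set.mem_univ, and_true]
      refine ⟨fun h => ?_, ?_⟩
      · have h' : (BratteliDiagram.FinPath.vertex v : Λ.bratteli.FinPath) = .vertex v₀ := h
        injection h'
      · rintro rfl
        rfl
    · change _ = ENNReal.ofReal ((Λ.rhoPow (rainbow k 0))⁻¹ * x v₀)
      rw [rainbow_zero, rhoPow_zero]
      simp
  | snoc γ e ih =>
    obtain ⟨v₀, s, t, hs, hmem, hprod⟩ := ih
    -- The coordinates used so far lie at levels below `γ.len`. The new edge therefore constrains a
    -- fresh coordinate, and its probability enters as one more factor.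
    have hns : endpoint γ ∉ s := fun h => (hs _ h).false
    have hne : ∀ p ∈ s, p ≠ endpoint γ := fun p hp h => hns (h ▸ hp)
    refine ⟨v₀, insert (endpoint γ) s, Function.update t (endpoint γ) {extEdge e}, ?_, ?_, ?_⟩
    · intro p hp
      rcases Finset.mem_insert.1 hp with rfl | hp
      · exact Nat.lt_succ_self _
      · exact (hs p hp).trans (Nat.lt_succ_self _)
    · intro v ω
      rw [EdgeChoice.path_mem_cylinder_snoc, hmem, Finset.coe_insert, Set.insert_pi]
      have hpi : ω ∈ Set.pi (s : Set (ℕ × Λ.Obj)) (Function.update t (endpoint γ) {extEdge e}) ↔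
          ω ∈ Set.pi (s : Set (ℕ × Λ.Obj)) t := by
        refine forall₂_congr fun p hp => ?_
        rw [Function.update_of_ne (hne p hp)]
      have hsing : (Function.eval (endpoint γ) ω ∈
          Function.update t (endpoint γ) {extEdge e} (endpoint γ)) ↔ ω (endpoint γ) = extEdge e := by
        rw [Function.update_self]; rfl
      rw [Set.mem_inter_iff, hpi, Set.mem_preimage, hsing]
      tauto
    · rw [Finset.prod_insert hns, Function.update_self, Finset.prod_congr rfl fun p hp => by
        rw [Function.update_of_ne (hne p hp)], mul_left_comm, hprod,
        PMF.toMeasure_apply_singleton _ _ MeasurableSpace.measurableSet_top]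
      rw [edgePMF, PMF.ofFintype_apply, ← ENNReal.ofReal_mul (div_nonneg (hx.pos _).le
        (mul_pos (hρ _) (hx.pos _)).le)]
      change ENNReal.ofReal (x e.1 / (Λ.rho (Fin.ofNat k γ.len) * x γ.src) *
        ((Λ.rhoPow (rainbow k γ.len))⁻¹ * x γ.src))
          = ENNReal.ofReal ((Λ.rhoPow (rainbow k (γ.len + 1)))⁻¹ * x e.1)
      rw [rainbow_succ, rhoPow_add, rhoPow_single]
      congr 1
      have h1 := (hρ (Fin.ofNat k γ.len)).ne'
      have h2 := (hx.pos γ.src).ne'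
      have h3 := (rhoPow_pos hρ (rainbow k γ.len)).ne'
      field_simp

/-- Start at `v` with probability `x_v` and choose an outgoing edge independently at every vertex of
every level. Following these choices is the required Markov chain. A product measure suffices since
a path meets each level once; cylinders pull back to boxes, whose probabilities telescope. -/
theorem exists_isPathMeasure (hx : Λ.IsPerronFrobenius Λ.perron) (hρ : ∀ i, 0 < Λ.rho i) :
    ∃ M, Λ.IsPathMeasure M := by
  classical
  set P : Measure Λ.EdgeChoice := Measure.infinitePi fun p : ℕ × Λ.Obj =>
    (edgePMF hx hρ (Fin.ofNat k p.1) p.2).toMeasure with hP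
  have hpre : ∀ (v : Λ.Obj) (γ : Λ.bratteli.FinPath),
      (fun ω : Λ.EdgeChoice => ofBratteli (ω.path v)) ⁻¹' pathCylinder γ
        = {ω | ω.path v ∈ BratteliDiagram.cylinder γ} := fun v γ => by
    ext ω; exact ofBratteli_mem_pathCylinder
  have hmeas : ∀ v : Λ.Obj, Measurable fun ω : Λ.EdgeChoice => ofBratteli (ω.path v) := by
    intro v
    rw [measurableSpace_eq_generateFrom Λ]
    refine measurable_generateFrom ?_
    rintro _ ⟨γ, rfl⟩
    obtain ⟨v₀, s, t, -, hmem, -⟩ := exists_box hx hρ γ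
    rw [hpre]
    simp only [hmem]
    by_cases hv : v = v₀
    · simp only [hv, true_and]
      exact MeasurableSet.pi s.countable_toSet fun p _ => trivial
    · simp [hv]
  set M : Measure Λ.InfPath := ∑ v : Λ.Obj,
    ENNReal.ofReal (Λ.perron v) • P.map fun ω => ofBratteli (ω.path v) with hM
  have happly : ∀ γ : Λ.bratteli.FinPath, M (pathCylinder γ)
      = ENNReal.ofReal ((Λ.rhoPow (rainbow k γ.len))⁻¹ * Λ.perron γ.src) := by
    intro γ
    obtain ⟨v₀, s, t, -, hmem, hprod⟩ := exists_box hx hρ γ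
    rw [← hprod, hM, Measure.finsetSum_apply, Finset.sum_eq_single v₀]
    · rw [Measure.smul_apply, Measure.map_apply (hmeas v₀) (isOpen_pathCylinder γ).measurableSet,
        hpre, smul_eq_mul]
      simp only [hmem, true_and]
      congr 1
      exact Measure.infinitePi_pi _ fun p _ => trivial
    · intro v _ hv
      rw [Measure.smul_apply, Measure.map_apply (hmeas v) (isOpen_pathCylinder γ).measurableSet,
        hpre, smul_eq_mul]
      simp [hmem, hv]
    · simp
  refine ⟨M, ⟨?_⟩, fun f => apply_cylinder_of_apply_pathCylinder hx hρ happly f⟩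
  rw [hM, Measure.finsetSum_apply]
  simp only [Measure.smul_apply, Measure.map_apply (hmeas _) MeasurableSet.univ,
    Set.preimage_univ, measure_univ, smul_eq_mul, mul_one]
  rw [← ENNReal.ofReal_sum_of_nonneg fun v _ => (hx.pos v).le, hx.sum_eq, ENNReal.ofReal_one]

theorem isPathMeasure_measure (hx : Λ.IsPerronFrobenius Λ.perron) (hρ : ∀ i, 0 < Λ.rho i) :
    Λ.IsPathMeasure Λ.measure := by
  have h := exists_isPathMeasure hx hρ
  rw [measure, dif_pos h]
  exact h.choose_spec

end KGraph

namespace KGraph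

variable {k : ℕ} {Λ : KGraph.{u} k} [Λ.IsFinite]

/-! ## Characteristic functions -/

theorem chi_eq_sum {ι : Type*} [Fintype ι] {S : Set Λ.InfPath} (hS : MeasurableSet S)
    {T : ι → Set Λ.InfPath} (hT : ∀ i, MeasurableSet (T i))
    (hd : Pairwise (Function.onFun Disjoint T)) (h : S = ⋃ i, T i) :
    chi hS = ∑ i, chi (hT i) := by
  classical
  have key : ∀ s : Finset ι, chi (Finset.measurableSet_biUnion s fun i _ => hT i)
      = ∑ i ∈ s, chi (hT i) := by
    intro s
    induction s using Finset.induction_on with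
    | empty =>
      simp only [chi, Finset.notMem_empty, Set.iUnion_false, Set.iUnion_empty,
        Finset.sum_empty, indicatorConstLp_empty]
    | insert i s hi ih =>
      rw [Finset.sum_insert hi, ← ih]
      simp only [chi, Finset.set_biUnion_insert]
      refine indicatorConstLp_disjoint_union _ _ _ _ ?_ _
      rw [Set.disjoint_iUnion₂_right]
      exact fun j hj => hd fun h => hi (h ▸ hj)
  rw [← key Finset.univ]
  simp only [h, Finset.mem_univ, Set.iUnion_true]

theorem inner_chi {S T : Set Λ.InfPath} (hS : MeasurableSet S) (hT : MeasurableSet T) :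
    inner ℂ (chi hS) (chi hT) = (Λ.measure.real (S ∩ T) : ℂ) :=
  L2.inner_indicatorConstLp_one_indicatorConstLp_one hS hT

theorem inner_chi_eq_zero {S T : Set Λ.InfPath} (hS : MeasurableSet S) (hT : MeasurableSet T)
    (h : Disjoint S T) : inner ℂ (chi hS) (chi hT) = 0 := by
  rw [inner_chi, h.inter_eq]; simp

variable [NeZero k]

/-! ## Cylinder sets and their masses -/

theorem measurableSet_pathCylinder (γ : Λ.bratteli.FinPath) :
    MeasurableSet (pathCylinder γ) := (isOpen_pathCylinder γ).measurableSet

theorem pathCylinder_snoc_subset (γ : Λ.bratteli.FinPath) (e : γ.Ext) :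
    pathCylinder (γ.snoc e.2) ⊆ pathCylinder γ :=
  Set.preimage_mono (BratteliDiagram.cylinder_snoc_subset γ e)

theorem exists_mem_pathCylinder_snoc {γ : Λ.bratteli.FinPath} {x : Λ.InfPath}
    (hx : x ∈ pathCylinder γ) : ∃ e : γ.Ext, x ∈ pathCylinder (γ.snoc e.2) :=
  BratteliDiagram.exists_mem_cylinder_snoc hx

theorem ext_eq_of_mem_pathCylinder {γ : Λ.bratteli.FinPath} {e e' : γ.Ext} {x : Λ.InfPath}
    (h : x ∈ pathCylinder (γ.snoc e.2)) (h' : x ∈ pathCylinder (γ.snoc e'.2)) : e = e' :=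
  BratteliDiagram.ext_eq_of_mem_cylinder h h'

theorem disjoint_pathCylinder {γ η : Λ.bratteli.FinPath} (hl : γ.len = η.len) (hne : γ ≠ η) :
    Disjoint (pathCylinder γ) (pathCylinder η) :=
  Set.disjoint_left.2 fun _ hγ hη => hne (BratteliDiagram.eq_of_mem_cylinder hγ hη hl)

theorem disjoint_pathCylinder_snoc (γ : Λ.bratteli.FinPath) {e e' : γ.Ext} (hne : e ≠ e') :
    Disjoint (pathCylinder (γ.snoc e.2)) (pathCylinder (γ.snoc e'.2)) :=
  disjoint_pathCylinder rfl fun h => hne (γ.snoc_injective h)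

theorem pathCylinder_eq_iUnion (γ : Λ.bratteli.FinPath) :
    pathCylinder γ = ⋃ e : γ.Ext, pathCylinder (γ.snoc e.2) :=
  Set.Subset.antisymm (fun _ hx => Set.mem_iUnion.2 (exists_mem_pathCylinder_snoc hx))
    (Set.iUnion_subset (pathCylinder_snoc_subset γ))

/-- The two cylinder sets are nested or disjoint. -/
theorem pathCylinder_subset_or_disjoint {γ η : Λ.bratteli.FinPath} (hl : γ.len ≤ η.len) :
    pathCylinder η ⊆ pathCylinder γ ∨ Disjoint (pathCylinder η) (pathCylinder γ) := by
  by_cases h : Disjoint (pathCylinder η) (pathCylinder γ)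
  · exact .inr h
  · obtain ⟨x, hη, hγ⟩ := Set.not_disjoint_iff.1 h
    exact .inl (Set.preimage_mono (BratteliDiagram.cylinder_subset_of_mem hγ hη hl))

/-- A vertex, as a path of the diagram. -/
def vertexPath (v : Λ.Obj) : Λ.bratteli.FinPath :=
  BratteliDiagram.FinPath.vertex (B := Λ.bratteli) v

theorem vertexPath_injective {v w : Λ.Obj} (h : vertexPath v = vertexPath w) : v = w := by
  have h' : (BratteliDiagram.FinPath.vertex v : Λ.bratteli.FinPath) = .vertex w := h
  injection h'

theorem disjoint_vertexPath {v w : Λ.Obj} (hne : v ≠ w) :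
    Disjoint (pathCylinder (vertexPath v)) (pathCylinder (vertexPath w)) :=
  disjoint_pathCylinder rfl fun h => hne (vertexPath_injective h)

theorem exists_mem_vertexPath (x : Λ.InfPath) : ∃ v, x ∈ pathCylinder (vertexPath v) :=
  ⟨x.toBratteli.vert 0, rfl⟩

variable (Λ) in
theorem univ_eq_iUnion_vertexPath :
    (Set.univ : Set Λ.InfPath) = ⋃ v : Λ.Obj, pathCylinder (vertexPath v) :=
  Set.Subset.antisymm (fun x _ => Set.mem_iUnion.2 (exists_mem_vertexPath x))
    (Set.subset_univ _)

/-- The measure of a cylinder set. -/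
noncomputable def mass (γ : Λ.bratteli.FinPath) : ℝ := Λ.measure.real (pathCylinder γ)

theorem sum_mass_snoc (γ : Λ.bratteli.FinPath) :
    ∑ e : γ.Ext, mass (γ.snoc e.2) = mass γ := by
  conv_rhs => rw [mass, pathCylinder_eq_iUnion]
  rw [measureReal_iUnion_fintype (fun e e' h => disjoint_pathCylinder_snoc γ h)
    fun e => measurableSet_pathCylinder _]
  rfl

theorem sum_mass_vertexPath [IsProbabilityMeasure Λ.measure] :
    ∑ v : Λ.Obj, mass (vertexPath v) = 1 := by
  rw [← probReal_univ (μ := Λ.measure), univ_eq_iUnion_vertexPath,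
    measureReal_iUnion_fintype (fun e e' h => disjoint_vertexPath h)
    fun e => measurableSet_pathCylinder _]
  rfl

theorem mass_pos (hM : Λ.IsPathMeasure Λ.measure) (hx : Λ.IsPerronFrobenius Λ.perron)
    (hρ : ∀ i, 0 < Λ.rho i) (γ : Λ.bratteli.FinPath) : 0 < mass γ := by
  rw [mass, pathCylinder_eq_cylinder, Measure.real, hM.apply_cylinder, ENNReal.toReal_ofReal]
  all_goals have := mul_pos (inv_pos.2 (rhoPow_pos hρ (Λ.deg (pathMor γ))))
              (hx.pos (Λ.s (pathMor γ)))
  · exact this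
  · exact this.le

/-! ## Relations between characteristic functions -/

theorem chiPath_eq_sum (γ : Λ.bratteli.FinPath) :
    chiPath γ = ∑ e : γ.Ext, chiPath (γ.snoc e.2) :=
  chi_eq_sum _ _ (fun _ _ h => disjoint_pathCylinder_snoc γ h) (pathCylinder_eq_iUnion γ)

variable (Λ) in
theorem chi_univ_eq_sum :
    chi (MeasurableSet.univ (α := Λ.InfPath)) = ∑ v : Λ.Obj, chiPath (vertexPath v) :=
  chi_eq_sum _ _ (fun _ _ h => disjoint_vertexPath h) (univ_eq_iUnion_vertexPath Λ)

theorem inner_chi_chiNormalized_of_subset {S : Set Λ.InfPath} (hS : MeasurableSet S)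
    {γ : Λ.bratteli.FinPath} (hpos : 0 < mass γ) (h : pathCylinder γ ⊆ S) :
    inner ℂ (chi hS) (chiNormalized γ) = 1 := by
  rw [chiNormalized, inner_smul_right, chiPath, inner_chi, Set.inter_eq_right.2 h]
  exact inv_mul_cancel₀ (Complex.ofReal_ne_zero.2 hpos.ne')

theorem inner_chi_chiNormalized_of_disjoint {S : Set Λ.InfPath} (hS : MeasurableSet S)
    {γ : Λ.bratteli.FinPath} (h : Disjoint S (pathCylinder γ)) :
    inner ℂ (chi hS) (chiNormalized γ) = 0 := by
  rw [chiNormalized, inner_smul_right, chiPath, inner_chi_eq_zero _ _ h, mul_zero]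

theorem mass_smul_chiNormalized {γ : Λ.bratteli.FinPath} (hpos : 0 < mass γ) :
    (mass γ : ℂ) • chiNormalized γ = chiPath γ := by
  rw [chiNormalized, smul_smul]
  change ((mass γ : ℂ) * (mass γ : ℂ)⁻¹) • _ = _
  rw [mul_inv_cancel₀ (Complex.ofReal_ne_zero.2 hpos.ne'), one_smul]

/-- Each term of a sum of vectors `m i • u i` lies in the span of the sum and of the
differences of the `u i`. -/
theorem smul_mem_sup_span_sub {ι V : Type*} [Fintype ι] [AddCommGroup V] [Module ℂ V]
    {E : Submodule ℂ V} {m : ι → ℂ} {u : ι → V} (hm : ∑ i, m i ≠ 0)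
    (hE : ∀ i j, i ≠ j → u i - u j ∈ E) (i : ι) :
    m i • u i ∈ Submodule.span ℂ {∑ j, m j • u j} ⊔ E := by
  -- `u i` minus the weighted mean of all `u j` is the weighted mean of the differences `u i - u j`.
  have h1 : m i • u i = (m i / ∑ j, m j) • ∑ j, m j • u j +
      ∑ j, (m i * m j / ∑ j, m j) • (u i - u j) := by
    simp only [smul_sub, Finset.sum_sub_distrib, ← Finset.sum_smul, ← Finset.sum_div,
      ← Finset.mul_sum, Finset.smul_sum, smul_smul, div_mul_eq_mul_div]
    rw [mul_div_assoc, div_self hm, mul_one]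
    abel
  rw [h1]
  refine add_mem (Submodule.mem_sup_left (Submodule.smul_mem _ _
    (Submodule.mem_span_singleton_self _))) (Submodule.mem_sup_right
      (Submodule.sum_mem _ fun j _ => Submodule.smul_mem _ _ ?_))
  by_cases h : i = j
  · rw [h, sub_self]; exact zero_mem _
  · exact hE i j h

/-! ## The spaces of functions of a finite number of edges -/

variable (Λ) in
/-- The span of the characteristic functions of the paths of length `m`. -/
noncomputable def levelSpace (m : ℕ) : Submodule ℂ Λ.L2 :=
  Submodule.span ℂ {φ | ∃ γ : Λ.bratteli.FinPath, γ.len = m ∧ φ = chiPath γ}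

theorem chiPath_mem_levelSpace (γ : Λ.bratteli.FinPath) : chiPath γ ∈ Λ.levelSpace γ.len :=
  Submodule.subset_span ⟨γ, rfl, rfl⟩

theorem chiPath_eq_chiMor (γ : Λ.bratteli.FinPath) : chiPath γ = chiMor (pathMor γ) := by
  simp only [chiPath, chiMor, chi, pathCylinder_eq_cylinder]

theorem scalingSpace_eq_levelSpace (n : ℕ) : Λ.scalingSpace n = Λ.levelSpace (n * k) := by
  refine le_antisymm (Submodule.span_mono ?_) (Submodule.span_mono ?_)
  · rintro _ ⟨f, hf, rfl⟩
    obtain ⟨γ, hγ, rfl⟩ := exists_pathMor_eq (hf.trans (rainbow_mul k n).symm)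
    exact ⟨γ, hγ, (chiPath_eq_chiMor γ).symm⟩
  · rintro _ ⟨γ, hγ, rfl⟩
    exact ⟨pathMor γ, by rw [deg_pathMor, hγ, rainbow_mul], chiPath_eq_chiMor γ⟩

theorem levelSpace_le_succ (m : ℕ) : Λ.levelSpace m ≤ Λ.levelSpace (m + 1) := by
  refine Submodule.span_le.2 ?_
  rintro _ ⟨γ, rfl, rfl⟩
  rw [chiPath_eq_sum]
  exact Submodule.sum_mem _ fun e _ => chiPath_mem_levelSpace (γ.snoc e.2)

variable (Λ) in
theorem levelSpace_mono : Monotone Λ.levelSpace := monotone_nat_of_le_succ levelSpace_le_succ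

theorem eigenspacePath_le (γ : Λ.bratteli.FinPath) :
    Λ.eigenspacePath γ ≤ Λ.levelSpace (γ.len + 1) := by
  refine Submodule.span_le.2 ?_
  rintro _ ⟨e, e', -, rfl⟩
  exact sub_mem (Submodule.smul_mem _ _ (chiPath_mem_levelSpace (γ.snoc e.2)))
    (Submodule.smul_mem _ _ (chiPath_mem_levelSpace (γ.snoc e'.2)))

/-! ### Adding one edge: the spaces `E_γ` as orthogonal complements -/

section Decomposition

variable (hpos : ∀ γ : Λ.bratteli.FinPath, 0 < mass γ)
include hpos

/-- A function of the first `m ≤ |γ|` edges is constant on `[γ]`, where the generators of `E_γ` live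
and have integral zero. -/
theorem levelSpace_isOrtho_eigenspacePath {m : ℕ} {γ : Λ.bratteli.FinPath} (h : m ≤ γ.len) :
    Λ.levelSpace m ⟂ Λ.eigenspacePath γ := by
  refine Submodule.isOrtho_span.2 ?_
  rintro _ ⟨η, rfl, rfl⟩ _ ⟨e, e', -, rfl⟩
  rw [inner_sub_right, sub_eq_zero, chiPath]
  rcases pathCylinder_subset_or_disjoint h with h | h
  · rw [inner_chi_chiNormalized_of_subset _ (hpos _) ((pathCylinder_snoc_subset γ e).trans h),
      inner_chi_chiNormalized_of_subset _ (hpos _) ((pathCylinder_snoc_subset γ e').trans h)]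
  · rw [inner_chi_chiNormalized_of_disjoint _ (h.symm.mono_right (pathCylinder_snoc_subset γ e)),
      inner_chi_chiNormalized_of_disjoint _ (h.symm.mono_right (pathCylinder_snoc_subset γ e'))]

/-- For equal lengths the supports are disjoint. Otherwise the space of the shorter path consists of
functions of no more edges than the length of the longer. -/
theorem eigenspacePath_isOrtho {γ η : Λ.bratteli.FinPath} (hne : γ ≠ η) :
    Λ.eigenspacePath γ ⟂ Λ.eigenspacePath η := by
  rcases lt_trichotomy γ.len η.len with h | h | h
  · exact (levelSpace_isOrtho_eigenspacePath hpos h).mono_left (eigenspacePath_le γ)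
  · refine Submodule.isOrtho_span.2 ?_
    have key : ∀ (e : γ.Ext) (e' : η.Ext),
        inner ℂ (chiNormalized (γ.snoc e.2)) (chiNormalized (η.snoc e'.2)) = 0 := by
      intro e e'
      rw [chiNormalized, inner_smul_left, chiPath, inner_chi_chiNormalized_of_disjoint, mul_zero]
      exact (disjoint_pathCylinder h hne).mono (pathCylinder_snoc_subset γ e)
        (pathCylinder_snoc_subset η e')
    rintro _ ⟨e₁, e₂, -, rfl⟩ _ ⟨e₃, e₄, -, rfl⟩
    rw [inner_sub_left, inner_sub_right, inner_sub_right]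
    simp only [key, sub_self]
  · exact ((levelSpace_isOrtho_eigenspacePath hpos h).mono_left (eigenspacePath_le η)).symm

/-- Weighted by the masses, the normalized characteristic functions of the extensions of `γ` sum to
`χ_[γ]`. Their differences lie in `E_γ`, so `smul_mem_sup_span_sub` applies. -/
theorem levelSpace_succ_le (m : ℕ) : Λ.levelSpace (m + 1) ≤
    Λ.levelSpace m ⊔ ⨆ γ ∈ {γ : Λ.bratteli.FinPath | γ.len = m}, Λ.eigenspacePath γ := by
  refine Submodule.span_le.2 ?_
  rintro _ ⟨ζ, hζ, rfl⟩
  obtain ⟨γ, e, rfl, rfl⟩ := BratteliDiagram.FinPath.exists_eq_snoc hζ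
  have h := smul_mem_sup_span_sub (E := Λ.eigenspacePath γ)
    (m := fun e : γ.Ext => (mass (γ.snoc e.2) : ℂ)) (u := fun e => chiNormalized (γ.snoc e.2))
    (by rw [← Complex.ofReal_sum, sum_mass_snoc]; exact Complex.ofReal_ne_zero.2 (hpos γ).ne')
    (fun e e' hne => Submodule.subset_span ⟨e, e', hne, rfl⟩) e
  simp only [mass_smul_chiNormalized (hpos _), ← chiPath_eq_sum] at h
  refine SetLike.le_def.1 (sup_le_sup ?_ ?_) h
  · rw [Submodule.span_singleton_le_iff_mem]
    exact chiPath_mem_levelSpace γ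
  · exact le_iSup₂_of_le (f := fun γ (_ : γ ∈ _) => Λ.eigenspacePath γ) γ rfl le_rfl

theorem levelSpace_add (m j : ℕ) : Λ.levelSpace (m + j) = Λ.levelSpace m ⊔
    ⨆ γ ∈ {γ : Λ.bratteli.FinPath | m ≤ γ.len ∧ γ.len < m + j}, Λ.eigenspacePath γ := by
  refine le_antisymm ?_ (sup_le (levelSpace_mono Λ (Nat.le_add_right m j))
    (iSup₂_le fun γ hγ => (eigenspacePath_le γ).trans (levelSpace_mono Λ hγ.2)))
  induction j with
  | zero => exact le_sup_left
  | succ j ih =>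
    refine (levelSpace_succ_le hpos (m + j)).trans (sup_le (ih.trans (sup_le_sup le_rfl ?_))
      (le_sup_of_le_right ?_))
    · exact biSup_mono fun γ hγ => ⟨hγ.1, by have := hγ.2; omega⟩
    · refine biSup_mono fun γ (hγ : γ.len = m + j) => ⟨by omega, by omega⟩

theorem scalingSpace_succ (n : ℕ) : Λ.scalingSpace (n + 1) = Λ.scalingSpace n ⊔
    ⨆ γ ∈ {γ : Λ.bratteli.FinPath | n * k ≤ γ.len ∧ γ.len < (n + 1) * k},
      Λ.eigenspacePath γ := by
  rw [scalingSpace_eq_levelSpace, scalingSpace_eq_levelSpace, Nat.succ_mul, levelSpace_add hpos]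

/-- The span `U` of the `E_γ` lies in `𝒱_n^⊥` and `𝒱_{n+1} = 𝒱_n ⊔ U`. The modular law gives `(U ⊔
𝒱_n) ⊓ 𝒱_n^⊥ = U`. -/
theorem waveletSpace_eq (n : ℕ) : Λ.waveletSpace n =
    ⨆ γ ∈ {γ : Λ.bratteli.FinPath | n * k ≤ γ.len ∧ γ.len < (n + 1) * k},
      Λ.eigenspacePath γ := by
  have hle : (⨆ γ ∈ {γ : Λ.bratteli.FinPath | n * k ≤ γ.len ∧ γ.len < (n + 1) * k},
      Λ.eigenspacePath γ) ≤ (Λ.scalingSpace n)ᗮ := by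
    refine iSup₂_le fun γ hγ => ?_
    rw [scalingSpace_eq_levelSpace]
    exact (levelSpace_isOrtho_eigenspacePath hpos hγ.1).symm
  rw [waveletSpace, scalingSpace_succ hpos, sup_comm, sup_inf_assoc_of_le _ hle,
    Submodule.inf_orthogonal_eq_bot, sup_bot_eq]

theorem scalingSpace_succ_eq_sup (n : ℕ) :
    Λ.scalingSpace (n + 1) = Λ.scalingSpace n ⊔ Λ.waveletSpace n := by
  rw [waveletSpace_eq hpos, scalingSpace_succ hpos]

end Decomposition

/-! ## The wavelet decomposition -/

variable (Λ) in
theorem scalingSpace_mono : Monotone Λ.scalingSpace := fun m n h => by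
  rw [scalingSpace_eq_levelSpace, scalingSpace_eq_levelSpace]
  exact levelSpace_mono Λ (Nat.mul_le_mul_right k h)

theorem scalingSpace_isOrtho_waveletSpace {m n : ℕ} (h : m ≤ n) :
    Λ.scalingSpace m ⟂ Λ.waveletSpace n :=
  (Submodule.isOrtho_iff_le.2 (le_refl _)).symm.mono (scalingSpace_mono Λ h) inf_le_right

theorem waveletSpace_isOrtho {m n : ℕ} (h : m ≠ n) : Λ.waveletSpace m ⟂ Λ.waveletSpace n := by
  wlog hlt : m < n generalizing m n
  · exact (this h.symm (lt_of_le_of_ne (not_lt.1 hlt) h.symm)).symm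
  · exact (scalingSpace_isOrtho_waveletSpace hlt).mono_left inf_le_left

variable (Λ) in
theorem isPiSystem_range_pathCylinder : IsPiSystem (Set.range (pathCylinder (Λ := Λ))) := by
  rintro _ ⟨γ, rfl⟩ _ ⟨η, rfl⟩ hne
  rcases le_total γ.len η.len with h | h
  · rcases pathCylinder_subset_or_disjoint h with h' | h'
    · exact ⟨η, (Set.inter_eq_right.2 h').symm⟩
    · exact absurd h'.symm.inter_eq hne.ne_empty
  · rcases pathCylinder_subset_or_disjoint h with h' | h'
    · exact ⟨γ, (Set.inter_eq_left.2 h').symm⟩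
    · exact absurd h'.inter_eq hne.ne_empty

/-- The inner products are integrals of `φ` over path cylinders. These form a generating π-system,
so all set integrals of `φ` vanish. -/
theorem eq_zero_of_inner_chiPath_eq_zero {φ : Λ.L2}
    (h : ∀ γ : Λ.bratteli.FinPath, inner ℂ (chiPath γ) φ = 0) : φ = 0 := by
  have hint : Integrable φ Λ.measure := (Lp.memLp φ).integrable one_le_two
  have hset : ∀ {S : Set Λ.InfPath} (hS : MeasurableSet S),
      inner ℂ (chi hS) φ = ∫ x in S, φ x ∂Λ.measure := fun hS =>
    L2.inner_indicatorConstLp_one hS (measure_ne_top _ _) φ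
  have huniv : ∫ x, φ x ∂Λ.measure = 0 := by
    rw [← setIntegral_univ, ← hset MeasurableSet.univ, chi_univ_eq_sum, sum_inner]
    exact Finset.sum_eq_zero fun v _ => h _
  have hall : ∀ S, MeasurableSet S → ∫ x in S, φ x ∂Λ.measure = 0 := by
    refine MeasurableSpace.induction_on_inter (measurableSpace_eq_generateFrom Λ)
      (isPiSystem_range_pathCylinder Λ) (by simp) ?_ ?_ ?_
    · rintro _ ⟨γ, rfl⟩
      rw [← hset (measurableSet_pathCylinder γ)]
      exact h γ
    · intro S hS h0
      have := integral_add_compl hS hint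
      rwa [h0, zero_add, huniv] at this
    · intro S hd hS h0
      rw [integral_iUnion hS hd hint.integrableOn]
      simp [h0]
  rw [Lp.eq_zero_iff_ae_eq_zero]
  exact hint.ae_eq_zero_of_forall_setIntegral_eq_zero fun S hS _ => hall S hS

theorem topologicalClosure_eq_top (hpos : ∀ γ : Λ.bratteli.FinPath, 0 < mass γ) :
    (Λ.scalingSpace 0 ⊔ ⨆ n, Λ.waveletSpace n).topologicalClosure = ⊤ := by
  have hle : ∀ n, Λ.scalingSpace n ≤ Λ.scalingSpace 0 ⊔ ⨆ n, Λ.waveletSpace n := by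
    intro n
    induction n with
    | zero => exact le_sup_left
    | succ n ih =>
      rw [scalingSpace_succ_eq_sup hpos]
      exact sup_le ih (le_sup_of_le_right (le_iSup Λ.waveletSpace n))
  rw [Submodule.topologicalClosure_eq_top_iff, Submodule.eq_bot_iff]
  intro φ hφ
  refine eq_zero_of_inner_chiPath_eq_zero fun γ => (Submodule.mem_orthogonal _ _).1 hφ _
    (hle γ.len ?_)
  rw [scalingSpace_eq_levelSpace]
  -- As `|γ| ≤ |γ| * k`, the function `χ_[γ]` already lies in the scaling space of index `|γ|`.
  exact levelSpace_mono Λ (Nat.le_mul_of_pos_right _ (NeZero.pos k)) (chiPath_mem_levelSpace γ)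

/-! ## The decomposition of the first scaling space -/

section Root

variable (hpos : ∀ γ : Λ.bratteli.FinPath, 0 < mass γ)
include hpos

theorem eigenspaceConst_isOrtho_eigenspaceRoot : Λ.eigenspaceConst ⟂ Λ.eigenspaceRoot := by
  refine Submodule.isOrtho_span.2 ?_
  rintro _ rfl _ ⟨v, v', -, rfl⟩
  rw [inner_sub_right, inner_chi_chiNormalized_of_subset _ (hpos _) (Set.subset_univ _),
    inner_chi_chiNormalized_of_subset _ (hpos _) (Set.subset_univ _), sub_self]

/-- The splitting of `levelSpace_succ_le` at the root: vertices replace extensions, and the constant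
`1` replaces `χ_[γ]`. -/
theorem scalingSpace_zero_eq [IsProbabilityMeasure Λ.measure] :
    Λ.scalingSpace 0 = Λ.eigenspaceConst ⊔ Λ.eigenspaceRoot := by
  have hv : ∀ v : Λ.Obj, chiPath (vertexPath v) ∈ Λ.levelSpace 0 := fun v =>
    chiPath_mem_levelSpace (vertexPath v)
  rw [scalingSpace_eq_levelSpace, zero_mul]
  refine le_antisymm (Submodule.span_le.2 ?_) (sup_le ?_ (Submodule.span_le.2 ?_))
  · rintro _ ⟨γ, hγ, rfl⟩
    obtain ⟨v, rfl⟩ := BratteliDiagram.FinPath.exists_eq_vertex hγ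
    have h := smul_mem_sup_span_sub (E := Λ.eigenspaceRoot)
      (m := fun v : Λ.Obj => (mass (vertexPath v) : ℂ)) (u := fun v => chiNormalized (vertexPath v))
      (by rw [← Complex.ofReal_sum, sum_mass_vertexPath]; simp)
      (fun v v' hne => Submodule.subset_span ⟨v, v', hne, rfl⟩) v
    simp only [mass_smul_chiNormalized (hpos _), ← chi_univ_eq_sum] at h
    exact h
  · rw [eigenspaceConst, Submodule.span_singleton_le_iff_mem, chi_univ_eq_sum]
    exact Submodule.sum_mem _ fun v _ => hv v
  · rintro _ ⟨v, v', -, rfl⟩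
    exact sub_mem (Submodule.smul_mem _ _ (hv v)) (Submodule.smul_mem _ _ (hv v'))

end Root

end KGraph

namespace BratteliDiagram

variable {B : BratteliDiagram.{u}}

/-! ## The ultrametric of a weight -/

theorem InfPath.ext_of_trunc {x y : B.InfPath} (h : ∀ n, x.trunc n = y.trunc n) : x = y := by
  have hv : x.vert = y.vert := funext fun n => by
    have h1 := h n
    simp only [InfPath.trunc, FinPath.mk.injEq, true_and] at h1
    exact eq_of_heq h1.1
  have he : ∀ n, x.edge n ≍ y.edge n := fun n => by
    have h1 := h (n + 1)
    simp only [InfPath.trunc, InfPath.initial, FinPath.mk.injEq, true_and] at h1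
    have h2 := h1.2
    have h3 := h n
    simp only [InfPath.trunc, FinPath.mk.injEq, true_and] at h3
    have h4 := h3.2
    generalize x.edge n = e at *
    generalize y.edge n = e' at *
    generalize x.initial n = γ at *
    generalize y.initial n = γ' at *
    generalize x.vert n = p at *
    generalize x.vert (n + 1) = q at *
    obtain ⟨rfl, -⟩ := h3
    obtain ⟨rfl, -⟩ := h1
    injection eq_of_heq h2 with _ _ _ _ h5
    exact heq_of_eq h5
  obtain ⟨v, e⟩ := x
  obtain ⟨v', e'⟩ := y
  obtain rfl : v = v' := hv
  congr
  exact funext fun n => eq_of_heq (he n)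

theorem bddAbove_trunc_eq {x y : B.InfPath} (hne : x ≠ y) :
    BddAbove {n | x.trunc n = y.trunc n} := by
  obtain ⟨N, hN⟩ := not_forall.1 (mt InfPath.ext_of_trunc hne)
  exact ⟨N, fun n hn => not_lt.1 fun h => hN (InfPath.trunc_eq_of_le h.le hn)⟩

variable {w : B.FinPath → ℝ}

theorem trunc_eq_trunc_of_mem_cylinder {γ : B.FinPath} {x y : B.InfPath}
    (hx : x ∈ cylinder γ) (hy : y ∈ cylinder γ) : x.trunc γ.len = y.trunc γ.len :=
  (mem_cylinder.1 hx).trans (mem_cylinder.1 hy).symm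

theorem dist_le_of_mem_cylinder (hw : IsWeight w) {γ : B.FinPath} {x y : B.InfPath}
    (hx : x ∈ cylinder γ) (hy : y ∈ cylinder γ) : dist w x y ≤ w γ := by
  have htr := trunc_eq_trunc_of_mem_cylinder hx hy
  have h0 : ¬ x.trunc 0 ≠ y.trunc 0 := not_not.2 (InfPath.trunc_eq_of_le (Nat.zero_le _) htr)
  rw [dist, if_neg h0]
  split_ifs with hxy
  · exact (hw.pos γ).le
  · have hle : γ.len ≤ sSup {n | x.trunc n = y.trunc n} := le_csSup (bddAbove_trunc_eq hxy) htr
    have hsub := x.isSubpath_trunc hle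
    rw [mem_cylinder.1 hx] at hsub
    by_cases heq : γ = x.trunc (sSup {n | x.trunc n = y.trunc n})
    · exact (congrArg w heq).ge
    · exact (hw.strict _ _ hsub heq).le

theorem weight_snoc_lt (hw : IsWeight w) (γ : B.FinPath) (e : γ.Ext) : w (γ.snoc e.2) < w γ :=
  hw.strict _ _ (.snoc .refl e.2) fun h =>
    absurd (congrArg FinPath.len h) (Nat.succ_ne_self γ.len).symm

theorem dist_eq_of_mem_cylinder_snoc {γ : B.FinPath} {e e' : γ.Ext} (hne : e ≠ e')
    {x y : B.InfPath} (hx : x ∈ cylinder (γ.snoc e.2)) (hy : y ∈ cylinder (γ.snoc e'.2)) :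
    dist w x y = w γ := by
  have hx' := cylinder_snoc_subset γ e hx
  have hy' := cylinder_snoc_subset γ e' hy
  have htr := trunc_eq_trunc_of_mem_cylinder hx' hy'
  have h0 : ¬ x.trunc 0 ≠ y.trunc 0 := not_not.2 (InfPath.trunc_eq_of_le (Nat.zero_le _) htr)
  have hxy : x ≠ y := by
    rintro rfl
    exact hne (ext_eq_of_mem_cylinder hx hy)
  have hset : {n | x.trunc n = y.trunc n} = Set.Iic γ.len := by
    ext n
    refine ⟨fun hn => Set.mem_Iic.2 (not_lt.1 fun hlt => hne ?_), fun hn => InfPath.trunc_eq_of_le hn htr⟩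
    have h1 : x.trunc (γ.len + 1) = y.trunc (γ.len + 1) := InfPath.trunc_eq_of_le hlt hn
    have h2 : x.trunc (γ.len + 1) = γ.snoc e.2 := hx
    have h3 : y.trunc (γ.len + 1) = γ.snoc e'.2 := hy
    exact γ.snoc_injective (h2.symm.trans (h1.trans h3))
  rw [dist, if_neg h0, if_neg hxy, hset, csSup_Iic, mem_cylinder.1 hx']

/-- A path whose cylinder set has the weight as its diameter has two different extensions. -/
theorem exists_ext_ne (hw : IsWeight w) {γ : B.FinPath} (h : w γ = diam w γ) :
    ∃ e e' : γ.Ext, e ≠ e' := by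
  by_contra! hcon
  refine (hw.pos γ).not_ge ?_
  -- Without extensions `[γ]` is empty and its diameter is `sSup ∅ = 0`. With a single extension
  -- `e`, the diameter is at most the weight of `γ e`, which is below that of `γ`.
  rcases isEmpty_or_nonempty γ.Ext with hE | ⟨⟨e⟩⟩
  · have hemp : {d | ∃ x ∈ cylinder γ, ∃ y ∈ cylinder γ, d = dist w x y} = ∅ := by
      ext d
      simp only [Set.mem_ofPred_eq, Set.mem_empty_iff_false, iff_false]
      rintro ⟨x, hx, -⟩
      exact hE.false (exists_mem_cylinder_snoc hx).choose
    rw [h, diam, hemp, Real.sSup_empty]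
  · refine absurd h (ne_of_gt (lt_of_le_of_lt ?_ (weight_snoc_lt hw γ e)))
    refine Real.sSup_le ?_ (hw.pos _).le
    rintro _ ⟨x, hx, y, hy, rfl⟩
    obtain ⟨e₁, hx⟩ := exists_mem_cylinder_snoc hx
    obtain ⟨e₂, hy⟩ := exists_mem_cylinder_snoc hy
    rw [hcon e₁ e] at hx
    rw [hcon e₂ e] at hy
    exact dist_le_of_mem_cylinder hw hx hy

end BratteliDiagram

namespace KGraph

variable {k : ℕ} {Λ : KGraph.{u} k} [NeZero k] [Λ.IsFinite] {δ : ℝ}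

/-! ## The spaces of choice functions -/

/-- The pairs of different extensions of `γ`. -/
noncomputable def extPairs (γ : Λ.bratteli.FinPath) : Finset (γ.Ext × γ.Ext) :=
  by classical exact Finset.univ.filter fun p => p.1 ≠ p.2

theorem mem_extPairs {γ : Λ.bratteli.FinPath} {p : γ.Ext × γ.Ext} :
    p ∈ extPairs γ ↔ p.1 ≠ p.2 := by
  simp [extPairs]

/-- Points of `[γ]` that share the next edge `e` are at distance at most `w (γ e) < w γ = diam [γ]`.
Points that branch at `γ` are at distance exactly `w γ`. -/
theorem choicePairs_eq (hw : Λ.WeightEqDiam δ) (γ : Λ.bratteli.FinPath) :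
    Λ.choicePairs δ γ = ⋃ p ∈ extPairs γ,
      pathCylinder (γ.snoc p.1.2) ×ˢ pathCylinder (γ.snoc p.2.2) := by
  ext ⟨x, y⟩
  simp only [Set.mem_iUnion, exists_prop]
  constructor
  · rintro ⟨hx, hy, hd⟩
    obtain ⟨e, hx⟩ := exists_mem_pathCylinder_snoc hx
    obtain ⟨e', hy⟩ := exists_mem_pathCylinder_snoc hy
    refine ⟨(e, e'), mem_extPairs.2 fun (h : e = e') => ?_, hx, hy⟩
    subst h
    rw [← hw.eq_diam] at hd
    exact ((BratteliDiagram.dist_le_of_mem_cylinder hw.isWeight hx hy).trans_lt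
      (BratteliDiagram.weight_snoc_lt hw.isWeight γ e)).ne hd
  · rintro ⟨⟨e, e'⟩, hne, hx, hy⟩
    refine ⟨pathCylinder_snoc_subset γ e hx, pathCylinder_snoc_subset γ e' hy, ?_⟩
    rw [← hw.eq_diam]
    exact BratteliDiagram.dist_eq_of_mem_cylinder_snoc (mem_extPairs.1 hne) hx hy

theorem measurableSet_choicePairs (hw : Λ.WeightEqDiam δ) (γ : Λ.bratteli.FinPath) :
    MeasurableSet (Λ.choicePairs δ γ) := by
  rw [choicePairs_eq hw]
  exact Finset.measurableSet_biUnion _ fun p _ =>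
    (measurableSet_pathCylinder _).prod (measurableSet_pathCylinder _)

/-- The equality of weight and diameter forces two different extensions of `γ`. The product of their
cylinder sets has positive measure. -/
theorem measure_choicePairs_ne_zero (hw : Λ.WeightEqDiam δ)
    (hpos : ∀ γ : Λ.bratteli.FinPath, 0 < mass γ) (γ : Λ.bratteli.FinPath) :
    (Λ.measure.prod Λ.measure) (Λ.choicePairs δ γ) ≠ 0 := by
  obtain ⟨e, e', hne⟩ := BratteliDiagram.exists_ext_ne hw.isWeight (hw.eq_diam γ)
  have hm : ∀ η : Λ.bratteli.FinPath, Λ.measure (pathCylinder η) ≠ 0 := fun η h =>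
    (hpos η).ne' (by rw [mass, Measure.real, h, ENNReal.toReal_zero])
  have hle : pathCylinder (γ.snoc e.2) ×ˢ pathCylinder (γ.snoc e'.2) ⊆ Λ.choicePairs δ γ := by
    rw [choicePairs_eq hw]
    exact Set.subset_biUnion_of_mem (u := fun p : γ.Ext × γ.Ext =>
      pathCylinder (γ.snoc p.1.2) ×ˢ pathCylinder (γ.snoc p.2.2)) (x := (e, e'))
      (mem_extPairs.2 hne)
  intro h0
  have := measure_mono_null hle h0
  rw [Measure.prod_prod] at this
  exact mul_ne_zero (hm _) (hm _) this

theorem isProbabilityMeasure_choiceMeasureAt (hw : Λ.WeightEqDiam δ)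
    (hpos : ∀ γ : Λ.bratteli.FinPath, 0 < mass γ) (γ : Λ.bratteli.FinPath) :
    IsProbabilityMeasure (Λ.choiceMeasureAt δ γ) :=
  ProbabilityTheory.cond_isProbabilityMeasure (measure_choicePairs_ne_zero hw hpos γ)

end KGraph

namespace KGraph

variable {k : ℕ} {Λ : KGraph.{u} k}

/-! ## Bounded measurable functions on the infinite path space -/

/-- Bounded Borel functions on the infinite path space. -/
structure IsBoundedMeasurable (f : Λ.InfPath → ℂ) : Prop where
  measurable : Measurable f
  bounded : ∃ C, ∀ x, ‖f x‖ ≤ C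

theorem IsBoundedMeasurable.integrable {f : Λ.InfPath → ℂ} (hf : IsBoundedMeasurable f)
    (μ : Measure Λ.InfPath) [IsFiniteMeasure μ] : Integrable f μ := by
  obtain ⟨C, hC⟩ := hf.bounded
  exact Integrable.of_bound hf.measurable.aestronglyMeasurable C (.of_forall hC)

theorem IsBoundedMeasurable.conj_mul {f g : Λ.InfPath → ℂ} (hf : IsBoundedMeasurable f)
    (hg : IsBoundedMeasurable g) :
    IsBoundedMeasurable fun x => (starRingEnd ℂ) (g x) * f x := by
  obtain ⟨C, hC⟩ := hf.bounded
  obtain ⟨D, hD⟩ := hg.bounded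
  refine ⟨(Complex.continuous_conj.measurable.comp hg.measurable).mul hf.measurable,
    D * C, fun x => ?_⟩
  rw [norm_mul, RCLike.norm_conj]
  exact mul_le_mul (hD x) (hC x) (norm_nonneg _) ((norm_nonneg _).trans (hD x))

/-- The integrand of the Dirichlet form. -/
noncomputable def differenceProduct (g f : Λ.InfPath → ℂ) (p : Λ.InfPath × Λ.InfPath) : ℂ :=
  (starRingEnd ℂ) (g p.1 - g p.2) * (f p.1 - f p.2)

theorem IsBoundedMeasurable.measurable_differenceProduct {f g : Λ.InfPath → ℂ}
    (hf : IsBoundedMeasurable f) (hg : IsBoundedMeasurable g) :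
    Measurable (differenceProduct g f) :=
  (Complex.continuous_conj.measurable.comp ((hg.measurable.comp measurable_fst).sub
    (hg.measurable.comp measurable_snd))).mul
    ((hf.measurable.comp measurable_fst).sub (hf.measurable.comp measurable_snd))

theorem IsBoundedMeasurable.integrable_differenceProduct {f g : Λ.InfPath → ℂ}
    (hf : IsBoundedMeasurable f) (hg : IsBoundedMeasurable g)
    (ν : Measure (Λ.InfPath × Λ.InfPath)) [IsFiniteMeasure ν] :
    Integrable (differenceProduct g f) ν := by
  have hm := hf.measurable_differenceProduct hg
  obtain ⟨C, hC⟩ := hf.bounded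
  obtain ⟨D, hD⟩ := hg.bounded
  refine Integrable.of_bound hm.aestronglyMeasurable ((D + D) * (C + C)) (.of_forall fun p => ?_)
  rw [differenceProduct, norm_mul, RCLike.norm_conj]
  have h1 : ‖g p.1 - g p.2‖ ≤ D + D := (norm_sub_le _ _).trans (add_le_add (hD _) (hD _))
  exact mul_le_mul h1 ((norm_sub_le _ _).trans (add_le_add (hC _) (hC _)))
    (norm_nonneg _) ((norm_nonneg _).trans h1)

theorem setIntegral_differenceProduct [Λ.IsFinite] {f g : Λ.InfPath → ℂ} (hf : IsBoundedMeasurable f)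
    (hg : IsBoundedMeasurable g) (S T : Set Λ.InfPath) :
    ∫ p in S ×ˢ T, differenceProduct g f p ∂(Λ.measure.prod Λ.measure) =
      (∫ x in S, (starRingEnd ℂ) (g x) * f x ∂Λ.measure) * Λ.measure.real T
      - (∫ x in S, (starRingEnd ℂ) (g x) ∂Λ.measure) * (∫ x in T, f x ∂Λ.measure)
      - (∫ x in S, f x ∂Λ.measure) * (∫ x in T, (starRingEnd ℂ) (g x) ∂Λ.measure)
      + Λ.measure.real S * (∫ x in T, (starRingEnd ℂ) (g x) * f x ∂Λ.measure) := by
  have h1 : IsBoundedMeasurable fun _ : Λ.InfPath => (1 : ℂ) :=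
    ⟨measurable_const, 1, by simp⟩
  have hg' : IsBoundedMeasurable fun x => (starRingEnd ℂ) (g x) := by
    simpa using h1.conj_mul hg
  have hgf := hf.conj_mul hg
  have hi : ∀ {a b : Λ.InfPath → ℂ}, IsBoundedMeasurable a → IsBoundedMeasurable b →
      Integrable (fun p : Λ.InfPath × Λ.InfPath => a p.1 * b p.2)
        ((Λ.measure.prod Λ.measure).restrict (S ×ˢ T)) := fun ha hb =>
    ((ha.integrable _).mul_prod (hb.integrable _)).integrableOn
  have heq : ∀ p : Λ.InfPath × Λ.InfPath, differenceProduct g f p =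
      ((starRingEnd ℂ) (g p.1) * f p.1) * 1 - (starRingEnd ℂ) (g p.1) * f p.2
      -- The factors `1` put each of the four terms in the form `a x * b y`, to which Fubini
      -- applies.
      - f p.1 * (starRingEnd ℂ) (g p.2) + 1 * ((starRingEnd ℂ) (g p.2) * f p.2) := fun p => by
    rw [differenceProduct, map_sub]; ring
  simp only [heq]
  have hAB : Integrable (fun p : Λ.InfPath × Λ.InfPath =>
      ((starRingEnd ℂ) (g p.1) * f p.1) * 1 - (starRingEnd ℂ) (g p.1) * f p.2)
      ((Λ.measure.prod Λ.measure).restrict (S ×ˢ T)) := (hi hgf h1).sub (hi hg' hf)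
  have hABC : Integrable (fun p : Λ.InfPath × Λ.InfPath =>
      ((starRingEnd ℂ) (g p.1) * f p.1) * 1 - (starRingEnd ℂ) (g p.1) * f p.2
        - f p.1 * (starRingEnd ℂ) (g p.2))
      ((Λ.measure.prod Λ.measure).restrict (S ×ˢ T)) := hAB.sub (hi hf hg')
  rw [integral_add hABC (hi h1 hgf), integral_sub hAB (hi hf hg'),
    integral_sub (hi hgf h1) (hi hg' hf),
    setIntegral_prod_mul (fun x => (starRingEnd ℂ) (g x) * f x) (fun _ => 1),
    setIntegral_prod_mul (fun x => (starRingEnd ℂ) (g x)) f,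
    setIntegral_prod_mul f (fun x => (starRingEnd ℂ) (g x)),
    setIntegral_prod_mul (fun _ => 1) (fun x => (starRingEnd ℂ) (g x) * f x)]
  simp

variable [NeZero k] [Λ.IsFinite] {δ : ℝ}

theorem indicator_mem_formDomain (γ : Λ.bratteli.FinPath) :
    (pathCylinder γ).indicator (1 : Λ.InfPath → ℂ) ∈ Λ.formDomain :=
  Submodule.subset_span ⟨γ, rfl⟩

theorem isBoundedMeasurable_of_mem_formDomain {f : Λ.InfPath → ℂ} (hf : f ∈ Λ.formDomain) :
    IsBoundedMeasurable f := by
  induction hf using Submodule.span_induction with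
  | mem f hf =>
    obtain ⟨γ, rfl⟩ := hf
    refine ⟨measurable_const.indicator (measurableSet_pathCylinder γ), 1, fun x => ?_⟩
    exact (norm_indicator_le_norm_self _ _).trans (by simp)
  | zero => exact ⟨measurable_const, 0, by simp⟩
  | add f g _ _ hf hg =>
    obtain ⟨C, hC⟩ := hf.bounded
    obtain ⟨D, hD⟩ := hg.bounded
    exact ⟨hf.measurable.add hg.measurable, C + D,
      fun x => (norm_add_le _ _).trans (add_le_add (hC x) (hD x))⟩
  | smul c f _ hf =>
    obtain ⟨C, hC⟩ := hf.bounded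
    exact ⟨hf.measurable.const_smul c, ‖c‖ * C, fun x => (norm_smul_le c (f x)).trans
      (mul_le_mul_of_nonneg_left (hC x) (norm_nonneg c))⟩

/-- `f` is constant on the cylinder set of `γ`. -/
def ConstOn (f : Λ.InfPath → ℂ) (γ : Λ.bratteli.FinPath) : Prop :=
  ∀ x ∈ pathCylinder γ, ∀ y ∈ pathCylinder γ, f x = f y

theorem ConstOn.mono {f : Λ.InfPath → ℂ} {γ η : Λ.bratteli.FinPath} (h : ConstOn f γ)
    (hle : pathCylinder η ⊆ pathCylinder γ) : ConstOn f η :=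
  fun x hx y hy => h x (hle hx) y (hle hy)

theorem constOn_of_forall_eq_zero {f : Λ.InfPath → ℂ} {γ : Λ.bratteli.FinPath}
    (h : ∀ x ∈ pathCylinder γ, f x = 0) : ConstOn f γ :=
  fun x hx y hy => (h x hx).trans (h y hy).symm

/-! ## The Dirichlet form as a finite sum -/

variable (Λ δ) in
/-- The factor of the block at `γ` in the Dirichlet form. -/
noncomputable def blockFactor (s : ℝ) (γ : Λ.bratteli.FinPath) : ℝ :=
  BratteliDiagram.diam (Λ.weight δ) γ ^ s * (1 / BratteliDiagram.diam (Λ.weight δ) γ) ^ 2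

/-- The commutator block is off-diagonal with entries `±(f x - f y) / diam`. The two entries
contribute equally, and the factor `2` cancels the `1/2` of the Dirichlet form. -/
theorem trace_block (s : ℝ) (τ : Λ.bratteli.FinPath → Λ.InfPath × Λ.InfPath)
    (g f : Λ.InfPath → ℂ) (γ : Λ.bratteli.FinPath) :
    (Λ.absDiracBlock δ s γ * (Λ.commutatorBlock δ τ g γ).conjTranspose *
      Λ.commutatorBlock δ τ f γ).trace
      = 2 * (Λ.blockFactor δ s γ : ℂ) * differenceProduct g f (τ γ) := by
  simp only [absDiracBlock, commutatorBlock, diracBlock, reprBlock, blockFactor,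
    differenceProduct]
  generalize BratteliDiagram.diam (Λ.weight δ) γ ^ s = a
  generalize (1 / BratteliDiagram.diam (Λ.weight δ) γ) = b
  simp [Matrix.trace_fin_two, Matrix.mul_apply, Fin.sum_univ_two]
  ring

/-- The contribution of the block at `γ` to the Dirichlet form. -/
noncomputable def blockForm (δ : ℝ) (γ : Λ.bratteli.FinPath) (g f : Λ.InfPath → ℂ) : ℂ :=
  ∫ p, differenceProduct g f p ∂(Λ.choiceMeasureAt δ γ)

section Form

variable (hw : Λ.WeightEqDiam δ) (hpos : ∀ γ : Λ.bratteli.FinPath, 0 < mass γ)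
include hw hpos

/-- Almost every choice function picks pairs inside `[γ]` for all of the countably many `γ` at once,
so blocks of length at least `n` vanish. Each remaining block depends on one coordinate of the
product measure and integrates against `N_γ`. -/
theorem dirichletForm_eq_sum {f g : Λ.InfPath → ℂ} (hf : IsBoundedMeasurable f)
    (hg : IsBoundedMeasurable g) {n : ℕ}
    (hn : ∀ γ : Λ.bratteli.FinPath, n ≤ γ.len → ConstOn f γ) (s : ℝ) :
    Λ.dirichletForm δ s g f =
      ∑ γ ∈ (BratteliDiagram.finite_len_lt (B := Λ.bratteli) n).toFinset,
        (Λ.blockFactor δ s γ : ℂ) * blockForm δ γ g f := by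
  have hprob : ∀ γ, IsProbabilityMeasure (Λ.choiceMeasureAt δ γ) :=
    isProbabilityMeasure_choiceMeasureAt hw hpos
  have hN : Λ.choiceMeasure δ = Measure.infinitePi (Λ.choiceMeasureAt δ) := dif_pos hprob
  have hev : ∀ γ, MeasurePreserving (Function.eval γ)
      (Λ.choiceMeasure δ) (Λ.choiceMeasureAt δ γ) := fun γ => by
    rw [hN]; exact measurePreserving_eval_infinitePi _ γ
  have hint : ∀ γ, Integrable (fun τ : Λ.bratteli.FinPath → Λ.InfPath × Λ.InfPath =>
      2 * (Λ.blockFactor δ s γ : ℂ) * differenceProduct g f (τ γ)) (Λ.choiceMeasure δ) :=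
    fun γ => ((hev γ).integrable_comp_of_integrable
      (hf.integrable_differenceProduct hg _)).const_mul _
  have hmem : ∀ᵐ τ ∂(Λ.choiceMeasure δ), ∀ γ, τ γ ∈ Λ.choicePairs δ γ := by
    rw [ae_all_iff]
    intro γ
    exact (hev γ).quasiMeasurePreserving.ae
      (ProbabilityTheory.ae_cond_mem (measurableSet_choicePairs hw γ))
  have hsum : ∀ᵐ τ ∂(Λ.choiceMeasure δ), (∑' γ : Λ.bratteli.FinPath,
      (Λ.absDiracBlock δ s γ * (Λ.commutatorBlock δ τ g γ).conjTranspose *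
        Λ.commutatorBlock δ τ f γ).trace)
      = ∑ γ ∈ (BratteliDiagram.finite_len_lt (B := Λ.bratteli) n).toFinset,
        2 * (Λ.blockFactor δ s γ : ℂ) * differenceProduct g f (τ γ) := by
    filter_upwards [hmem] with τ hτ
    simp only [trace_block]
    refine tsum_eq_sum fun γ hγ => ?_
    have hlen : n ≤ γ.len := by
      simpa using hγ
    rw [differenceProduct, hn γ hlen _ (hτ γ).1 _ (hτ γ).2.1, sub_self, mul_zero, mul_zero]
  rw [dirichletForm, integral_congr_ae hsum, integral_finsetSum _ fun γ _ => hint γ,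
    Finset.mul_sum]
  refine Finset.sum_congr rfl fun γ _ => ?_
  have hmap : ∫ τ, differenceProduct g f (τ γ) ∂(Λ.choiceMeasure δ) = blockForm δ γ g f := by
    rw [blockForm, ← (hev γ).map_eq, integral_map (hev γ).measurable.aemeasurable
      (hf.measurable_differenceProduct hg).aestronglyMeasurable]
  rw [integral_const_mul, hmap]
  ring

omit hpos in
theorem blockForm_eq_zero {f g : Λ.InfPath → ℂ} {γ : Λ.bratteli.FinPath} (h : ConstOn f γ) :
    blockForm δ γ g f = 0 := by
  refine integral_eq_zero_of_ae ?_
  filter_upwards [ProbabilityTheory.ae_cond_mem (measurableSet_choicePairs hw γ)] with p hp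
  rw [differenceProduct, h _ hp.1 _ hp.2.1, sub_self, mul_zero]
  rfl

/-! ## The blocks of the Dirichlet form -/

omit hw hpos in
theorem setIntegral_eq_sum_ext (γ : Λ.bratteli.FinPath) {f : Λ.InfPath → ℂ}
    (hf : IsBoundedMeasurable f) : ∫ x in pathCylinder γ, f x ∂Λ.measure
      = ∑ e : γ.Ext, ∫ x in pathCylinder (γ.snoc e.2), f x ∂Λ.measure := by
  rw [pathCylinder_eq_iUnion, integral_iUnion_fintype (fun e => measurableSet_pathCylinder _)
    (fun e e' h => disjoint_pathCylinder_snoc γ h) fun e => (hf.integrable _).integrableOn]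

omit hw hpos in
-- The sum over pairs of different extensions is the sum over all pairs, which factors, minus the
-- diagonal.
theorem sum_extPairs (γ : Λ.bratteli.FinPath) (a b c m : γ.Ext → ℂ) :
    ∑ p ∈ extPairs γ, (a p.1 * m p.2 - b p.1 * c p.2 - c p.1 * b p.2 + m p.1 * a p.2)
      = 2 * ((∑ e, m e) * (∑ e, a e) - (∑ e, b e) * (∑ e, c e)
        - ∑ e, (m e * a e - b e * c e)) := by
  classical
  have h : ∀ e e' : γ.Ext,
      (if e ≠ e' then a e * m e' - b e * c e' - c e * b e' + m e * a e' else 0)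
        = (a e * m e' - b e * c e' - c e * b e' + m e * a e')
          - if e = e' then a e * m e' - b e * c e' - c e * b e' + m e * a e' else 0 := by
    intro e e'
    split_ifs <;> simp_all
  have hfilter : extPairs γ = Finset.univ.filter fun p => p.1 ≠ p.2 := by
    ext p; simp [mem_extPairs]
  rw [hfilter, Finset.sum_filter, Fintype.sum_prod_type]
  simp only [h, Finset.sum_sub_distrib, Finset.sum_add_distrib, Finset.sum_ite_eq,
    Finset.mem_univ, if_true, ← Finset.mul_sum, ← Finset.sum_mul]
  simp only [mul_comm (m _), mul_comm (c _)]
  ring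

omit hpos in
theorem setIntegral_choicePairs (γ : Λ.bratteli.FinPath) {F : Λ.InfPath × Λ.InfPath → ℂ}
    (hF : Integrable F (Λ.measure.prod Λ.measure)) :
    ∫ p in Λ.choicePairs δ γ, F p ∂(Λ.measure.prod Λ.measure) =
      ∑ p ∈ extPairs γ, ∫ z in pathCylinder (γ.snoc p.1.2) ×ˢ pathCylinder (γ.snoc p.2.2),
        F z ∂(Λ.measure.prod Λ.measure) := by
  have hd : Set.Pairwise (extPairs γ : Set (γ.Ext × γ.Ext)) (Function.onFun Disjoint
      fun p => pathCylinder (γ.snoc p.1.2) ×ˢ pathCylinder (γ.snoc p.2.2)) := by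
    rintro ⟨e₁, e₂⟩ - ⟨e₃, e₄⟩ - hne
    refine Set.disjoint_left.2 fun z hz hz' => hne ?_
    rw [Prod.mk.injEq]
    exact ⟨ext_eq_of_mem_pathCylinder hz.1 hz'.1, ext_eq_of_mem_pathCylinder hz.2 hz'.2⟩
  rw [choicePairs_eq hw, integral_biUnion_finset _
    (fun p _ => (measurableSet_pathCylinder _).prod (measurableSet_pathCylinder _)) hd
    fun p _ => hF.integrableOn]

omit hpos in
/-- The block at `γ`, in terms of integrals over the cylinder sets of the extensions of `γ`. -/
theorem blockForm_eq (γ : Λ.bratteli.FinPath) {f g : Λ.InfPath → ℂ}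
    (hf : IsBoundedMeasurable f) (hg : IsBoundedMeasurable g) :
    blockForm δ γ g f =
      ((Λ.measure.prod Λ.measure).real (Λ.choicePairs δ γ) : ℂ)⁻¹ *
      (2 * (mass γ * (∫ x in pathCylinder γ, (starRingEnd ℂ) (g x) * f x ∂Λ.measure)
        - (∫ x in pathCylinder γ, (starRingEnd ℂ) (g x) ∂Λ.measure) *
          (∫ x in pathCylinder γ, f x ∂Λ.measure)
        - ∑ e : γ.Ext, (mass (γ.snoc e.2) *
            (∫ x in pathCylinder (γ.snoc e.2), (starRingEnd ℂ) (g x) * f x ∂Λ.measure)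
          - (∫ x in pathCylinder (γ.snoc e.2), (starRingEnd ℂ) (g x) ∂Λ.measure) *
            (∫ x in pathCylinder (γ.snoc e.2), f x ∂Λ.measure)))) := by
  have h1 : IsBoundedMeasurable fun _ : Λ.InfPath => (1 : ℂ) :=
    ⟨measurable_const, 1, by simp⟩
  have hg' : IsBoundedMeasurable fun x => (starRingEnd ℂ) (g x) := by
    simpa using h1.conj_mul hg
  have hsmul : blockForm δ γ g f =
      ((Λ.measure.prod Λ.measure).real (Λ.choicePairs δ γ) : ℂ)⁻¹ *
      ∫ p in Λ.choicePairs δ γ, differenceProduct g f p ∂(Λ.measure.prod Λ.measure) := by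
    rw [blockForm, choiceMeasureAt, ProbabilityTheory.cond, integral_smul_measure,
      ENNReal.toReal_inv, Complex.real_smul, Complex.ofReal_inv, Measure.real]
  rw [hsmul, setIntegral_choicePairs hw γ (hf.integrable_differenceProduct hg _),
    setIntegral_eq_sum_ext γ (hf.conj_mul hg), setIntegral_eq_sum_ext γ hf,
    setIntegral_eq_sum_ext γ hg', ← sum_mass_snoc γ, Complex.ofReal_sum,
    Finset.sum_congr rfl fun p _ => setIntegral_differenceProduct hf hg _ _]
  exact congrArg _ (sum_extPairs γ
    (fun e => ∫ x in pathCylinder (γ.snoc e.2), (starRingEnd ℂ) (g x) * f x ∂Λ.measure)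
    (fun e => ∫ x in pathCylinder (γ.snoc e.2), (starRingEnd ℂ) (g x) ∂Λ.measure)
    (fun e => ∫ x in pathCylinder (γ.snoc e.2), f x ∂Λ.measure)
    (fun e => (mass (γ.snoc e.2) : ℂ)))

end Form

end KGraph

namespace KGraph

variable {k : ℕ} {Λ : KGraph.{u} k} [NeZero k] [Λ.IsFinite] {δ : ℝ}

/-! ## Haar functions -/

/-- The functions on `[γ]` of mean zero that depend on the first edge after `γ` only. -/
structure IsHaarFunction (γ : Λ.bratteli.FinPath) (f : Λ.InfPath → ℂ) : Prop where
  mem : f ∈ Λ.formDomain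
  eq_zero : ∀ x ∉ pathCylinder γ, f x = 0
  constOn : ∀ e : γ.Ext, ConstOn f (γ.snoc e.2)
  integral : ∫ x, f x ∂Λ.measure = 0

theorem pathCylinder_nonempty {γ : Λ.bratteli.FinPath} (hpos : 0 < mass γ) :
    (pathCylinder γ).Nonempty := by
  rw [Set.nonempty_iff_ne_empty]
  intro h
  rw [mass, h, measureReal_empty] at hpos
  exact hpos.false

theorem chiPath_ae_eq (γ : Λ.bratteli.FinPath) :
    chiPath γ =ᵐ[Λ.measure] (pathCylinder γ).indicator (1 : Λ.InfPath → ℂ) :=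
  indicatorConstLp_coeFn (hs := measurableSet_pathCylinder γ) (hμs := measure_ne_top _ _)

theorem chiNormalized_ae_eq (γ : Λ.bratteli.FinPath) :
    chiNormalized γ =ᵐ[Λ.measure]
      (mass γ : ℂ)⁻¹ • (pathCylinder γ).indicator (1 : Λ.InfPath → ℂ) :=
  (Lp.coeFn_smul _ _).trans ((chiPath_ae_eq γ).const_smul _)

theorem chiNormalized_sub_ae_eq (γ η : Λ.bratteli.FinPath) :
    (chiNormalized γ - chiNormalized η : Λ.L2) =ᵐ[Λ.measure]
      (mass γ : ℂ)⁻¹ • (pathCylinder γ).indicator (1 : Λ.InfPath → ℂ)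
        - (mass η : ℂ)⁻¹ • (pathCylinder η).indicator (1 : Λ.InfPath → ℂ) :=
  (Lp.coeFn_sub _ _).trans ((chiNormalized_ae_eq γ).sub (chiNormalized_ae_eq η))

theorem integral_normalized_indicator {γ : Λ.bratteli.FinPath} (hpos : 0 < mass γ) :
    ∫ x, ((mass γ : ℂ)⁻¹ • (pathCylinder γ).indicator (1 : Λ.InfPath → ℂ)) x ∂Λ.measure = 1 := by
  simp only [Pi.smul_apply]
  rw [integral_smul, integral_indicator (measurableSet_pathCylinder γ)]
  simp only [Pi.one_apply, setIntegral_const, smul_eq_mul, Complex.real_smul, mul_one]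
  exact inv_mul_cancel₀ (Complex.ofReal_ne_zero.2 hpos.ne')

theorem constOn_indicator {γ η : Λ.bratteli.FinPath} (h : γ.len ≤ η.len) :
    ConstOn ((pathCylinder γ).indicator (1 : Λ.InfPath → ℂ)) η := by
  intro x hx y hy
  rcases pathCylinder_subset_or_disjoint h with h' | h'
  · rw [Set.indicator_of_mem (h' hx), Set.indicator_of_mem (h' hy)]; rfl
  · rw [Set.indicator_of_notMem (Set.disjoint_left.1 h' hx),
      Set.indicator_of_notMem (Set.disjoint_left.1 h' hy)]

theorem ConstOn.add {f g : Λ.InfPath → ℂ} {γ : Λ.bratteli.FinPath} (hf : ConstOn f γ)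
    (hg : ConstOn g γ) : ConstOn (f + g) γ := fun x hx y hy => by
  rw [Pi.add_apply, Pi.add_apply, hf x hx y hy, hg x hx y hy]

theorem ConstOn.sub {f g : Λ.InfPath → ℂ} {γ : Λ.bratteli.FinPath} (hf : ConstOn f γ)
    (hg : ConstOn g γ) : ConstOn (f - g) γ := fun x hx y hy => by
  rw [Pi.sub_apply, Pi.sub_apply, hf x hx y hy, hg x hx y hy]

theorem ConstOn.smul {f : Λ.InfPath → ℂ} {γ : Λ.bratteli.FinPath} (c : ℂ) (hf : ConstOn f γ) :
    ConstOn (c • f) γ := fun x hx y hy => by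
  rw [Pi.smul_apply, Pi.smul_apply, hf x hx y hy]

/-- The Dirichlet form takes functions, not classes modulo null sets, so elements of `E_γ` need
representatives whose properties hold at every point. -/
theorem exists_isHaarFunction (hpos : ∀ γ : Λ.bratteli.FinPath, 0 < mass γ)
    {γ : Λ.bratteli.FinPath} {φ : Λ.L2} (hφ : φ ∈ Λ.eigenspacePath γ) :
    ∃ f, IsHaarFunction γ f ∧ φ =ᵐ[Λ.measure] f := by
  induction hφ using Submodule.span_induction with
  | mem φ hφ =>
    obtain ⟨e, e', -, rfl⟩ := hφ
    have hd : ∀ e : γ.Ext, (mass (γ.snoc e.2) : ℂ)⁻¹ •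
        (pathCylinder (γ.snoc e.2)).indicator (1 : Λ.InfPath → ℂ) ∈ Λ.formDomain := fun e =>
      Submodule.smul_mem _ _ (indicator_mem_formDomain _)
    refine ⟨_, ⟨sub_mem (hd e) (hd e'), fun x hx => ?_,
      fun a => ?_, ?_⟩,
      chiNormalized_sub_ae_eq _ _⟩
    · simp [Set.indicator_of_notMem fun h => hx (pathCylinder_snoc_subset γ e h),
        Set.indicator_of_notMem fun h => hx (pathCylinder_snoc_subset γ e' h)]
    · have hc : ∀ b : γ.Ext, ConstOn ((mass (γ.snoc b.2) : ℂ)⁻¹ •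
          (pathCylinder (γ.snoc b.2)).indicator (1 : Λ.InfPath → ℂ)) (γ.snoc a.2) := fun b =>
        (constOn_indicator (γ := γ.snoc b.2) (η := γ.snoc a.2) le_rfl).smul _
      exact (hc e).sub (hc e')
    · refine (integral_sub ((isBoundedMeasurable_of_mem_formDomain (hd e)).integrable _)
        ((isBoundedMeasurable_of_mem_formDomain (hd e')).integrable _)).trans ?_
      rw [integral_normalized_indicator (hpos _), integral_normalized_indicator (hpos _), sub_self]
  | zero =>
    exact ⟨0, ⟨zero_mem _, fun _ _ => rfl, fun _ _ _ _ _ => rfl, by simp⟩, Lp.coeFn_zero _ _ _⟩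
  | add φ ψ _ _ hφ hψ =>
    obtain ⟨f, hf, hφf⟩ := hφ
    obtain ⟨g, hg, hψg⟩ := hψ
    refine ⟨f + g, ⟨add_mem hf.mem hg.mem, fun x hx => ?_, fun e => (hf.constOn e).add
      (hg.constOn e), ?_⟩, (Lp.coeFn_add _ _).trans (hφf.add hψg)⟩
    · rw [Pi.add_apply, hf.eq_zero x hx, hg.eq_zero x hx, add_zero]
    · refine (integral_add ((isBoundedMeasurable_of_mem_formDomain hf.mem).integrable _)
        ((isBoundedMeasurable_of_mem_formDomain hg.mem).integrable _)).trans ?_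
      rw [hf.integral, hg.integral, add_zero]
  | smul c φ _ hφ =>
    obtain ⟨f, hf, hφf⟩ := hφ
    refine ⟨c • f, ⟨Submodule.smul_mem _ _ hf.mem, fun x hx => ?_, fun e => (hf.constOn e).smul c,
      ?_⟩, (Lp.coeFn_smul _ _).trans (hφf.const_smul c)⟩
    · rw [Pi.smul_apply, hf.eq_zero x hx, smul_zero]
    · refine (integral_smul c f).trans ?_
      rw [hf.integral, smul_zero]

theorem IsHaarFunction.constOn_of_len_lt {γ η : Λ.bratteli.FinPath} {f : Λ.InfPath → ℂ}
    (hf : IsHaarFunction γ f) (h : γ.len < η.len) : ConstOn f η := by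
  rcases pathCylinder_subset_or_disjoint h.le with h' | h'
  · intro x hx
    obtain ⟨e, he⟩ := exists_mem_pathCylinder_snoc (h' hx)
    have hle : (γ.snoc e.2).len ≤ η.len := h
    have hsub := (pathCylinder_subset_or_disjoint hle).resolve_right
      (Set.not_disjoint_iff.2 ⟨x, hx, he⟩)
    exact (hf.constOn e).mono hsub x hx
  · exact constOn_of_forall_eq_zero fun x hx => hf.eq_zero x (Set.disjoint_left.1 h' hx)

/-- The integral over `[η]` of a function that vanishes off `[γ] ⊆ [η]`. -/
theorem setIntegral_eq_integral_of_subset {γ η : Λ.bratteli.FinPath} {F : Λ.InfPath → ℂ}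
    (hF : ∀ x ∉ pathCylinder γ, F x = 0) (h : pathCylinder γ ⊆ pathCylinder η) :
    ∫ x in pathCylinder η, F x ∂Λ.measure = ∫ x, F x ∂Λ.measure :=
  setIntegral_eq_integral_of_forall_compl_eq_zero fun x hx => hF x fun hx' => hx (h hx')

theorem setIntegral_eq_zero_of_disjoint {γ η : Λ.bratteli.FinPath} {F : Λ.InfPath → ℂ}
    (hF : ∀ x ∉ pathCylinder γ, F x = 0) (h : Disjoint (pathCylinder γ) (pathCylinder η)) :
    ∫ x in pathCylinder η, F x ∂Λ.measure = 0 :=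
  setIntegral_eq_zero_of_forall_eq_zero fun x hx => hF x (Set.disjoint_right.1 h hx)

section Eigen

variable (hw : Λ.WeightEqDiam δ) (hpos : ∀ γ : Λ.bratteli.FinPath, 0 < mass γ)
include hw hpos

/-- The block at `γ` acts on the Haar functions at `γ` by a scalar. -/
theorem blockForm_self (γ : Λ.bratteli.FinPath) {f g : Λ.InfPath → ℂ}
    (hf : IsHaarFunction γ f) (hg : IsBoundedMeasurable g) :
    blockForm δ γ g f =
      ((((Λ.measure.prod Λ.measure).real (Λ.choicePairs δ γ))⁻¹ * (2 * mass γ) : ℝ) : ℂ) *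
        ∫ x, (starRingEnd ℂ) (g x) * f x ∂Λ.measure := by
  -- Since `f` is constant on each `[γ e]`, the diagonal terms vanish. The cross term has the factor
  -- `∫ f = 0`, leaving `mass γ` times the inner product.
  have hdiag : ∀ e : γ.Ext, (mass (γ.snoc e.2) : ℂ) *
      (∫ x in pathCylinder (γ.snoc e.2), (starRingEnd ℂ) (g x) * f x ∂Λ.measure)
      - (∫ x in pathCylinder (γ.snoc e.2), (starRingEnd ℂ) (g x) ∂Λ.measure) *
        (∫ x in pathCylinder (γ.snoc e.2), f x ∂Λ.measure) = 0 := by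
    intro e
    obtain ⟨y, hy⟩ := pathCylinder_nonempty (hpos (γ.snoc e.2))
    have hm := measurableSet_pathCylinder (γ.snoc e.2)
    rw [setIntegral_congr_fun (g := fun x => (starRingEnd ℂ) (g x) * f y) hm
        fun x hx => by simp only [hf.constOn e x hx y hy],
      setIntegral_congr_fun (g := fun _ => f y) hm fun x hx => hf.constOn e x hx y hy,
      integral_mul_const, setIntegral_const, Complex.real_smul, mass]
    ring
  rw [blockForm_eq hw γ (isBoundedMeasurable_of_mem_formDomain hf.mem) hg,
    Finset.sum_eq_zero fun e _ => hdiag e,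
    setIntegral_eq_integral_of_subset hf.eq_zero subset_rfl, hf.integral,
    setIntegral_eq_integral_of_subset
      (fun x hx => by rw [hf.eq_zero x hx, mul_zero]) (subset_refl (pathCylinder γ))]
  push_cast
  ring

omit hpos in
/-- The block at `η` acts on the Haar functions at an extension `γ` of `η a` by a scalar. -/
theorem blockForm_of_subset {γ η : Λ.bratteli.FinPath} {a : η.Ext}
    (ha : pathCylinder γ ⊆ pathCylinder (η.snoc a.2)) {f g : Λ.InfPath → ℂ}
    (hf : IsHaarFunction γ f) (hg : IsBoundedMeasurable g) :
    blockForm δ η g f = ((((Λ.measure.prod Λ.measure).real (Λ.choicePairs δ η))⁻¹ *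
        (2 * (mass η - mass (η.snoc a.2))) : ℝ) : ℂ) *
        ∫ x, (starRingEnd ℂ) (g x) * f x ∂Λ.measure := by
  classical
  have hgf : ∀ x ∉ pathCylinder γ, (starRingEnd ℂ) (g x) * f x = 0 := fun x hx => by
    rw [hf.eq_zero x hx, mul_zero]
  have hη := ha.trans (pathCylinder_snoc_subset η a)
  have hdisj : ∀ e : η.Ext, e ≠ a → Disjoint (pathCylinder γ) (pathCylinder (η.snoc e.2)) :=
    fun e he => (disjoint_pathCylinder_snoc η he.symm).mono_left ha
  -- All of `f` lives in `[η a]` and has mean zero, so every product of separate integrals vanishes.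
  -- Of the diagonal only the `a` term survives, and it is subtracted from `mass η`.
  have hfe : ∀ e : η.Ext, ∫ x in pathCylinder (η.snoc e.2), f x ∂Λ.measure = 0 := fun e => by
    by_cases he : e = a
    · rw [he, setIntegral_eq_integral_of_subset hf.eq_zero ha, hf.integral]
    · exact setIntegral_eq_zero_of_disjoint hf.eq_zero (hdisj e he)
  rw [blockForm_eq hw η (isBoundedMeasurable_of_mem_formDomain hf.mem) hg,
    setIntegral_eq_integral_of_subset hf.eq_zero hη, hf.integral,
    setIntegral_eq_integral_of_subset hgf hη,
    Finset.sum_eq_single a (fun e _ he => by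
      rw [hfe, setIntegral_eq_zero_of_disjoint hgf (hdisj e he)]; simp) (by simp),
    hfe, setIntegral_eq_integral_of_subset hgf ha]
  push_cast
  ring

/-- The constant precedes `f` and `g`, so that one eigenvalue serves the whole space. It can be
nonzero only if `η` is `γ` or an initial segment of `γ`; otherwise `f` is constant on `[η]`. -/
theorem exists_blockForm_eq (γ η : Λ.bratteli.FinPath) :
    ∃ c : ℝ, ∀ f g : Λ.InfPath → ℂ, IsHaarFunction γ f → IsBoundedMeasurable g →
      blockForm δ η g f = c * ∫ x, (starRingEnd ℂ) (g x) * f x ∂Λ.measure := by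
  have hconst : (∀ f, IsHaarFunction γ f → ConstOn f η) →
      ∃ c : ℝ, ∀ f g : Λ.InfPath → ℂ, IsHaarFunction γ f → IsBoundedMeasurable g →
        blockForm δ η g f = c * ∫ x, (starRingEnd ℂ) (g x) * f x ∂Λ.measure := fun h =>
    ⟨0, fun f g hf _ => by rw [blockForm_eq_zero hw (h f hf)]; simp⟩
  have hzero : Disjoint (pathCylinder γ) (pathCylinder η) →
      ∀ f, IsHaarFunction γ f → ConstOn f η := fun h f hf =>
    constOn_of_forall_eq_zero fun x hx => hf.eq_zero x (Set.disjoint_right.1 h hx)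
  rcases lt_trichotomy γ.len η.len with h | h | h
  · exact hconst fun f hf => hf.constOn_of_len_lt h
  · by_cases heq : γ = η
    · subst heq
      exact ⟨_, fun f g hf hg => blockForm_self hw hpos γ hf hg⟩
    · exact hconst (hzero (disjoint_pathCylinder h heq))
  · rcases pathCylinder_subset_or_disjoint h.le with h' | h'
    · obtain ⟨x, hx⟩ := pathCylinder_nonempty (hpos γ)
      obtain ⟨a, ha⟩ := exists_mem_pathCylinder_snoc (h' hx)
      have hle : (η.snoc a.2).len ≤ γ.len := h
      have hsub := (pathCylinder_subset_or_disjoint hle).resolve_right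
        (Set.not_disjoint_iff.2 ⟨x, hx, ha⟩)
      exact ⟨_, fun f g hf hg => blockForm_of_subset hw hsub hf hg⟩
    · exact hconst (hzero h')

/-! ## The eigenspaces of the Laplace–Beltrami operators -/

theorem consistsOfEigenvectors_eigenspacePath (s : ℝ) (γ : Λ.bratteli.FinPath) :
    Λ.ConsistsOfEigenvectors δ s (Λ.eigenspacePath γ) := by
  choose c hc using exists_blockForm_eq hw hpos γ
  -- The bound `γ.len + 1` keeps the block at `γ` itself; on all longer paths `f` is constant.
  refine ⟨∑ η ∈ (BratteliDiagram.finite_len_lt (B := Λ.bratteli) (γ.len + 1)).toFinset,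
    Λ.blockFactor δ s η * c η, fun φ hφ => ?_⟩
  obtain ⟨f, hf, hφf⟩ := exists_isHaarFunction hpos hφ
  refine ⟨f, hf.mem, hφf, fun g hg => ?_⟩
  have hgm := isBoundedMeasurable_of_mem_formDomain hg
  rw [dirichletForm_eq_sum hw hpos (isBoundedMeasurable_of_mem_formDomain hf.mem) hgm
    (fun η hη => hf.constOn_of_len_lt hη) s]
  simp only [hc _ f g hf hgm, ← mul_assoc, ← Complex.ofReal_mul]
  rw [← Finset.sum_mul, ← Complex.ofReal_sum, ← integral_const_mul]
  refine integral_congr_ae ?_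
  filter_upwards [Lp.coeFn_smul ((∑ η ∈ (BratteliDiagram.finite_len_lt (B := Λ.bratteli)
    (γ.len + 1)).toFinset, Λ.blockFactor δ s η * c η : ℝ) : ℂ) φ, hφf] with x hx hx'
  rw [hx, Pi.smul_apply, hx', smul_eq_mul]
  ring

/-- Functions of the range of a path are in the kernel of the operators. -/
theorem consistsOfEigenvectors_of_constOn (s : ℝ) {E : Submodule ℂ Λ.L2}
    (hE : ∀ φ ∈ E, ∃ f ∈ Λ.formDomain, (∀ γ : Λ.bratteli.FinPath, ConstOn f γ) ∧
      φ =ᵐ[Λ.measure] f) : Λ.ConsistsOfEigenvectors δ s E := by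
  refine ⟨0, fun φ hφ => ?_⟩
  obtain ⟨f, hf, hconst, hφf⟩ := hE φ hφ
  refine ⟨f, hf, hφf, fun g hg => ?_⟩
  rw [dirichletForm_eq_sum hw hpos (isBoundedMeasurable_of_mem_formDomain hf)
    (isBoundedMeasurable_of_mem_formDomain hg) (n := 0) (fun γ _ => hconst γ) s,
    Finset.sum_eq_zero fun γ _ => by rw [blockForm_eq_zero hw (hconst γ), mul_zero]]
  refine integral_eq_zero_of_ae ?_
  filter_upwards [Lp.coeFn_smul ((0 : ℝ) : ℂ) φ] with x hx
  rw [hx]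
  simp

omit hw hpos in
theorem exists_constOn_of_mem_levelSpace_zero {φ : Λ.L2} (hφ : φ ∈ Λ.levelSpace 0) :
    ∃ f ∈ Λ.formDomain, (∀ γ : Λ.bratteli.FinPath, ConstOn f γ) ∧ φ =ᵐ[Λ.measure] f := by
  induction hφ using Submodule.span_induction with
  | mem φ hφ =>
    obtain ⟨γ, hγ, rfl⟩ := hφ
    exact ⟨_, indicator_mem_formDomain γ, fun η => constOn_indicator (hγ ▸ Nat.zero_le _),
      chiPath_ae_eq γ⟩
  | zero => exact ⟨0, zero_mem _, fun _ _ _ _ _ => rfl, Lp.coeFn_zero _ _ _⟩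
  | add φ ψ _ _ hφ hψ =>
    obtain ⟨f, hf, hfc, hφf⟩ := hφ
    obtain ⟨g, hg, hgc, hψg⟩ := hψ
    exact ⟨f + g, add_mem hf hg, fun γ => (hfc γ).add (hgc γ),
      (Lp.coeFn_add _ _).trans (hφf.add hψg)⟩
  | smul c φ _ hφ =>
    obtain ⟨f, hf, hfc, hφf⟩ := hφ
    exact ⟨c • f, Submodule.smul_mem _ _ hf, fun γ => (hfc γ).smul c,
      (Lp.coeFn_smul _ _).trans (hφf.const_smul c)⟩

theorem consistsOfEigenvectors_of_le_scalingSpace_zero (s : ℝ) {E : Submodule ℂ Λ.L2}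
    (hE : E ≤ Λ.scalingSpace 0) : Λ.ConsistsOfEigenvectors δ s E := by
  rw [scalingSpace_eq_levelSpace, zero_mul] at hE
  exact consistsOfEigenvectors_of_constOn hw hpos s fun φ hφ =>
    exists_constOn_of_mem_levelSpace_zero (hE hφ)

end Eigen

end KGraph

/-! ### The eigenspaces refine the wavelet decomposition -/

theorem theorem4p6 {k : ℕ} [NeZero k] (Λ : KGraph.{u} k) [Λ.IsFinite] [Nonempty Λ.Obj]
    (hconn : Λ.StronglyConnected) (hirr : Λ.adjProd.IsIrreducible)
    (δ : ℝ) (hδ : δ ∈ Set.Ioo (0 : ℝ) 1) (hw : Λ.WeightEqDiam δ) :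
    -- `x^Λ` and `M` exist (the definitions of `perron` and `measure` do not take a default value)
    (Λ.IsPerronFrobenius Λ.perron ∧ Λ.IsPathMeasure Λ.measure) ∧
    -- the wavelet decomposition of `L²(Λ^∞, M)`
    ((∀ n, Λ.scalingSpace 0 ⟂ Λ.waveletSpace n) ∧
      (∀ m n, m ≠ n → Λ.waveletSpace m ⟂ Λ.waveletSpace n) ∧
      (Λ.scalingSpace 0 ⊔ ⨆ n, Λ.waveletSpace n).topologicalClosure = ⊤) ∧
    -- the spaces `E_{-1}`, `E_0`, `E_γ` consist of eigenvectors of every `Δ_s`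
    (∀ s : ℝ, Λ.ConsistsOfEigenvectors δ s Λ.eigenspaceConst ∧
      Λ.ConsistsOfEigenvectors δ s Λ.eigenspaceRoot ∧
      ∀ γ : Λ.bratteli.FinPath, Λ.ConsistsOfEigenvectors δ s (Λ.eigenspacePath γ)) ∧
    -- `𝒱_0 = E_{-1} ⊕ E_0`
    (Λ.eigenspaceConst ⟂ Λ.eigenspaceRoot ∧
      Λ.scalingSpace 0 = Λ.eigenspaceConst ⊔ Λ.eigenspaceRoot) ∧
    -- `𝒲_n` is the orthogonal direct sum of the `E_γ` with `nk ≤ |γ| < (n+1)k`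
    (∀ γ η : Λ.bratteli.FinPath, γ ≠ η → Λ.eigenspacePath γ ⟂ Λ.eigenspacePath η) ∧
    (∀ n : ℕ, Λ.waveletSpace n =
      ⨆ γ ∈ {γ : Λ.bratteli.FinPath | n * k ≤ γ.len ∧ γ.len < (n + 1) * k},
        Λ.eigenspacePath γ) := by
  have hx := KGraph.isPerronFrobenius_perron hirr
  have hρ := KGraph.rho_pos hirr
  have hM := KGraph.isPathMeasure_measure hx hρ
  have hpos := KGraph.mass_pos hM hx hρ
  have hprob := hM.prob
  have hV0 := KGraph.scalingSpace_zero_eq hpos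
  refine ⟨⟨hx, hM⟩, ⟨fun n => KGraph.scalingSpace_isOrtho_waveletSpace (Nat.zero_le n),
    fun m n => KGraph.waveletSpace_isOrtho, KGraph.topologicalClosure_eq_top hpos⟩,
    fun s => ⟨?_, ?_, KGraph.consistsOfEigenvectors_eigenspacePath hw hpos s⟩,
    ⟨KGraph.eigenspaceConst_isOrtho_eigenspaceRoot hpos, hV0⟩,
    fun γ η => KGraph.eigenspacePath_isOrtho hpos, KGraph.waveletSpace_eq hpos⟩
  -- Both `E_{-1}` and `E_0` lie in `𝒱_0`, which every `Δ_s` annihilates.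
  · exact KGraph.consistsOfEigenvectors_of_le_scalingSpace_zero hw hpos s (hV0 ▸ le_sup_left)
  · exact KGraph.consistsOfEigenvectors_of_le_scalingSpace_zero hw hpos s (hV0 ▸ le_sup_right)
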